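/- Let $k$ be a field and let $A,B,C,D$ be finite-dimensional $k$-algebras. For finite-dimensional $k$-algebras $R,S$, an $R$-$S$-bimodule is a left module over $R\otimes_k S^{\mathrm{op}}$, and $\mathcal D^-(R\otimes_k S^{\mathrm{op}})$ denotes the derived category of bounded above complexes of finitely generated $R$-$S$-bimodules, i.e. the localization of the category of such complexes at the quasi-isomorphisms. Then the total left derived functors of the tensor product bifunctors on bounded above complexes exist; they are bifunctors $$-\otimes^{\mathbb L}_B-\colon \mathcal D^-(A\otimes_k B^{\mathrm{op}})\times\mathcal D^-(B\otimes_k C^{\mathrm{op}})\to\mathcal D^-(A\otimes_k C^{\mathrm{op}}),$$ and likewise $\mathcal D^-(A\otimes_k B^{\mathrm{op}})\times\mathcal D^-(B\otimes_k D^{\mathrm{op}})\to\mathcal D^-(A\otimes_k D^{\mathrm{op}})$ over $B$, and $-\otimes^{\mathbb L}_C-$ from $\mathcal D^-(A\otimes_k C^{\mathrm{op}})\times\mathcal D^-(C\otimes_k D^{\mathrm{op}})$ to $\mathcal D^-(A\otimes_k D^{\mathrm{op}})$ and from $\mathcal D^-(B\otimes_k C^{\mathrm{op}})\times\mathcal D^-(C\otimes_k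 D^{\mathrm{op}})$ to $\mathcal D^-(B\otimes_k D^{\mathrm{op}})$. Moreover, there is an isomorphism $$(L^*\otimes^{\mathbb L}_B M^*)\otimes^{\mathbb L}_C N^*\;\cong\;L^*\otimes^{\mathbb L}_B(M^*\otimes^{\mathbb L}_C N^*)$$ in $\mathcal D^-(A\otimes_k D^{\mathrm{op}})$, natural in all three factors $L^*\in\mathcal D^-(A\otimes_k B^{\mathrm{op}})$, $M^*\in\mathcal D^-(B\otimes_k C^{\mathrm{op}})$, $N^*\in\mathcal D^-(C\otimes_k D^{\mathrm{op}})$. In particular, for bounded complexes of bimodules $L^*$, $M^*$, $N^*$ there are natural isomorphisms of functors \begin{align*} (-\otimes^{\mathbb L}_B M^*)\otimes^{\mathbb L}_C N^*&\cong -\otimes^{\mathbb L}_B(M^*\otimes^{\mathbb L}_C N^*)\colon \mathcal D^-(A\otimes_k B^{\mathrm{op}})\to\mathcal D^-(A\otimes_k D^{\mathrm{op}}),\\ (L^*\otimes^{\mathbb L}_B -)\otimes^{\mathbb L}_C N^*&\cong L^*\otimes^{\mathbb L}_B(-\otimes^{\mathbb L}_C N^*)\colon \mathcal D^-(B\otimes_k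 C^{\mathrm{op}})\to\mathcal D^-(A\otimes_k D^{\mathrm{op}}),\\ (L^*\otimes^{\mathbb L}_B M^*)\otimes^{\mathbb L}_C -&\cong L^*\otimes^{\mathbb L}_B(M^*\otimes^{\mathbb L}_C -)\colon \mathcal D^-(C\otimes_k D^{\mathrm{op}})\to\mathcal D^-(A\otimes_k D^{\mathrm{op}}). \end{align*} -/

import Mathlib

open CategoryTheory Limits
open scoped TensorProduct

universe u

noncomputable section

namespace DerivedTensor

section BalancedTensor

/-! ### The tensor product `L ⊗_B M` of an `A`-`B`-bimodule and a `B`-`C`-bimodule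

An `A`-`B`-bimodule (with central action of the base field `k`) is a left module over
`A ⊗[k] Bᵐᵒᵖ`: `a l b = (a ⊗ op b) • l`. -/

variable (k A B C : Type u) [Field k] [Ring A] [Algebra k A] [Ring B] [Algebra k B]
  [Ring C] [Algebra k C]
variable (L M : Type u)
  [AddCommGroup L] [Module k L] [Module (A ⊗[k] Bᵐᵒᵖ) L] [IsScalarTower k (A ⊗[k] Bᵐᵒᵖ) L]
  [AddCommGroup M] [Module k M] [Module (B ⊗[k] Cᵐᵒᵖ) M] [IsScalarTower k (B ⊗[k] Cᵐᵒᵖ) M]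

/-- The subspace of `L ⊗[k] M` spanned by the elements `l b ⊗ m - l ⊗ b m`. -/
def balancedRelations : Submodule k (L ⊗[k] M) :=
  Submodule.span k {x | ∃ (l : L) (b : B) (m : M),
    x = (((1 : A) ⊗ₜ[k] MulOpposite.op b) • l) ⊗ₜ[k] m -
      l ⊗ₜ[k] ((b ⊗ₜ[k] (1 : Cᵐᵒᵖ)) • m)}

/-- The tensor product `L ⊗_B M`. -/
def BalancedTensor : Type u := (L ⊗[k] M) ⧸ balancedRelations k A B C L M

instance : AddCommGroup (BalancedTensor k A B C L M) :=
  inferInstanceAs (AddCommGroup ((L ⊗[k] M) ⧸ balancedRelations k A B C L M))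

instance : Module k (BalancedTensor k A B C L M) :=
  inferInstanceAs (Module k ((L ⊗[k] M) ⧸ balancedRelations k A B C L M))

/-- The projection `L ⊗[k] M → L ⊗_B M`. -/
def BalancedTensor.mk : L ⊗[k] M →ₗ[k] BalancedTensor k A B C L M :=
  (balancedRelations k A B C L M).mkQ

theorem BalancedTensor.mk_surjective :
    Function.Surjective (BalancedTensor.mk k A B C L M) :=
  Submodule.mkQ_surjective _

/-- The action of `A ⊗[k] Cᵐᵒᵖ` on `L ⊗[k] M`: `(a ⊗ op c)` sends `l ⊗ m` to `a l ⊗ m c`. -/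
def outerAction : A ⊗[k] Cᵐᵒᵖ →ₐ[k] Module.End k (L ⊗[k] M) :=
  (Module.endTensorEndAlgHom (R := k) (S := k) (A := k) (M := L) (N := M)).comp
    (Algebra.TensorProduct.map
      ((Algebra.lsmul k k L).comp
        (Algebra.TensorProduct.includeLeft : A →ₐ[k] A ⊗[k] Bᵐᵒᵖ))
      ((Algebra.lsmul k k M).comp
        (Algebra.TensorProduct.includeRight : Cᵐᵒᵖ →ₐ[k] B ⊗[k] Cᵐᵒᵖ)))

theorem outerAction_tmul (a : A) (c : Cᵐᵒᵖ) (l : L) (m : M) :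
    outerAction k A B C L M (a ⊗ₜ c) (l ⊗ₜ m) =
      ((a ⊗ₜ[k] (1 : Bᵐᵒᵖ)) • l) ⊗ₜ[k] (((1 : B) ⊗ₜ[k] c) • m) := by
  simp [outerAction, Module.endTensorEndAlgHom_apply]

theorem balancedRelations_le_comap (r : A ⊗[k] Cᵐᵒᵖ) :
    balancedRelations k A B C L M ≤
      (balancedRelations k A B C L M).comap (outerAction k A B C L M r) := by
  induction r using TensorProduct.induction_on with
  | zero => intro x _; simp
  | add r s hr hs =>
    intro x hx
    have := (balancedRelations k A B C L M).add_mem (hr hx) (hs hx)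
    simpa using this
  | tmul a c =>
    refine Submodule.span_le.2 ?_
    rintro _ ⟨l, b, m, rfl⟩
    refine Submodule.subset_span ⟨(a ⊗ₜ[k] (1 : Bᵐᵒᵖ)) • l, b, ((1 : B) ⊗ₜ[k] c) • m, ?_⟩
    rw [map_sub, outerAction_tmul, outerAction_tmul]
    simp only [smul_smul, Algebra.TensorProduct.tmul_mul_tmul, one_mul, mul_one]

/-- The action of `A ⊗[k] Cᵐᵒᵖ` on `L ⊗_B M`: `(a ⊗ op c)` sends `l ⊗ m` to `a l ⊗ m c`. -/
def balancedAction : A ⊗[k] Cᵐᵒᵖ →+* Module.End k (BalancedTensor k A B C L M) where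
  toFun r := (balancedRelations k A B C L M).mapQ (balancedRelations k A B C L M)
    (outerAction k A B C L M r) (balancedRelations_le_comap k A B C L M r)
  map_one' := by
    refine Submodule.linearMap_qext _ (LinearMap.ext fun x => ?_)
    simp
    rfl
  map_mul' r s := by
    refine Submodule.linearMap_qext _ (LinearMap.ext fun x => ?_)
    simp
    rfl
  map_zero' := by
    refine Submodule.linearMap_qext _ (LinearMap.ext fun x => ?_)
    simp
    rfl
  map_add' r s := by
    refine Submodule.linearMap_qext _ (LinearMap.ext fun x => ?_)
    simp
    rfl

instance : Module (A ⊗[k] Cᵐᵒᵖ) (BalancedTensor k A B C L M) :=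
  Module.compHom _ (balancedAction k A B C L M)

theorem smul_mk (r : A ⊗[k] Cᵐᵒᵖ) (x : L ⊗[k] M) :
    r • BalancedTensor.mk k A B C L M x =
      BalancedTensor.mk k A B C L M (outerAction k A B C L M r x) := rfl

instance : IsScalarTower k (A ⊗[k] Cᵐᵒᵖ) (BalancedTensor k A B C L M) where
  smul_assoc c r x := by
    obtain ⟨x, rfl⟩ := BalancedTensor.mk_surjective k A B C L M x
    rw [smul_mk, smul_mk, map_smul, LinearMap.smul_apply, map_smul]

instance [Module.Finite k L] [Module.Finite k M] :
    Module.Finite (A ⊗[k] Cᵐᵒᵖ) (BalancedTensor k A B C L M) := by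
  have : Module.Finite k (BalancedTensor k A B C L M) :=
    Module.Finite.of_surjective _ (BalancedTensor.mk_surjective k A B C L M)
  exact Module.Finite.of_restrictScalars_finite k _ _

variable {L M}
variable {L' M' : Type u}
  [AddCommGroup L'] [Module k L'] [Module (A ⊗[k] Bᵐᵒᵖ) L'] [IsScalarTower k (A ⊗[k] Bᵐᵒᵖ) L']
  [AddCommGroup M'] [Module k M'] [Module (B ⊗[k] Cᵐᵒᵖ) M'] [IsScalarTower k (B ⊗[k] Cᵐᵒᵖ) M']

theorem balancedRelations_le_comap_map (f : L →ₗ[A ⊗[k] Bᵐᵒᵖ] L') (g : M →ₗ[B ⊗[k] Cᵐᵒᵖ] M') :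
    balancedRelations k A B C L M ≤ (balancedRelations k A B C L' M').comap
      (TensorProduct.map (f.restrictScalars k) (g.restrictScalars k)) := by
  refine Submodule.span_le.2 ?_
  rintro _ ⟨l, b, m, rfl⟩
  exact Submodule.subset_span ⟨f l, b, g m, by simp⟩

/-- The map `f ⊗_B g : L ⊗_B M → L' ⊗_B M'`. -/
def BalancedTensor.map (f : L →ₗ[A ⊗[k] Bᵐᵒᵖ] L') (g : M →ₗ[B ⊗[k] Cᵐᵒᵖ] M') :
    BalancedTensor k A B C L M →ₗ[A ⊗[k] Cᵐᵒᵖ] BalancedTensor k A B C L' M' where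
  toFun := (balancedRelations k A B C L M).mapQ (balancedRelations k A B C L' M')
    (TensorProduct.map (f.restrictScalars k) (g.restrictScalars k))
    (balancedRelations_le_comap_map k A B C f g)
  map_add' x y := map_add _ x y
  map_smul' r x := by
    obtain ⟨x, rfl⟩ := BalancedTensor.mk_surjective k A B C L M x
    rw [smul_mk]
    change BalancedTensor.mk k A B C L' M' (TensorProduct.map (f.restrictScalars k)
      (g.restrictScalars k) (outerAction k A B C L M r x)) =
      r • BalancedTensor.mk k A B C L' M' (TensorProduct.map (f.restrictScalars k)
      (g.restrictScalars k) x)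
    rw [smul_mk]
    congr 1
    induction r using TensorProduct.induction_on with
    | zero => simp
    | add r s hr hs => simp only [map_add, LinearMap.add_apply, hr, hs]
    | tmul a c =>
      induction x using TensorProduct.induction_on with
      | zero => simp
      | add x y hx hy => simp only [map_add, hx, hy]
      | tmul l m => simp [outerAction_tmul]

theorem BalancedTensor.map_mk (f : L →ₗ[A ⊗[k] Bᵐᵒᵖ] L') (g : M →ₗ[B ⊗[k] Cᵐᵒᵖ] M')
    (x : L ⊗[k] M) :
    BalancedTensor.map k A B C f g (BalancedTensor.mk k A B C L M x) =
      BalancedTensor.mk k A B C L' M'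
        (TensorProduct.map (f.restrictScalars k) (g.restrictScalars k) x) := rfl

theorem BalancedTensor.hom_ext {X : Type u} [AddCommGroup X] [Module (A ⊗[k] Cᵐᵒᵖ) X]
    {f g : BalancedTensor k A B C L M →ₗ[A ⊗[k] Cᵐᵒᵖ] X}
    (h : ∀ l m, f (BalancedTensor.mk k A B C L M (l ⊗ₜ m)) =
      g (BalancedTensor.mk k A B C L M (l ⊗ₜ m))) : f = g := by
  ext x
  obtain ⟨x, rfl⟩ := BalancedTensor.mk_surjective k A B C L M x
  induction x using TensorProduct.induction_on with
  | zero => simp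
  | add x y hx hy => simp only [map_add, hx, hy]
  | tmul l m => exact h l m

end BalancedTensor

section Bimodules

variable (k A B C : Type u) [Field k] [Ring A] [Algebra k A] [Ring B] [Algebra k B]
  [Ring C] [Algebra k C]

/-- The category of finitely generated `A`-`B`-bimodules. -/
abbrev FGBimod := FGModuleCat.{u} (A ⊗[k] Bᵐᵒᵖ)

instance [FiniteDimensional k A] [FiniteDimensional k B] : IsNoetherianRing (A ⊗[k] Bᵐᵒᵖ) :=
  IsNoetherianRing.of_finite k _

variable {k A B} in
/-- The `k`-vector space underlying a bimodule. -/
instance (X : FGBimod k A B) : Module k X :=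
  Module.compHom X (algebraMap k (A ⊗[k] Bᵐᵒᵖ))

variable {k A B} in
instance (X : FGBimod k A B) : IsScalarTower k (A ⊗[k] Bᵐᵒᵖ) X where
  smul_assoc c r x :=
    (congrArg (fun s : A ⊗[k] Bᵐᵒᵖ => s • x) (Algebra.smul_def c r)).trans
      (mul_smul (algebraMap k (A ⊗[k] Bᵐᵒᵖ) c) r x)

variable {k A B} in
instance [FiniteDimensional k A] [FiniteDimensional k B] (X : FGBimod k A B) :
    Module.Finite k X :=
  Module.Finite.trans (A ⊗[k] Bᵐᵒᵖ) X

variable [FiniteDimensional k A] [FiniteDimensional k B] [FiniteDimensional k C]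

/-- The bifunctor `(L, M) ↦ L ⊗_B M` on finitely generated bimodules. -/
def tensorBimod : FGBimod k A B ⥤ FGBimod k B C ⥤ FGBimod k A C where
  obj L :=
    { obj M := FGModuleCat.of (A ⊗[k] Cᵐᵒᵖ) (BalancedTensor k A B C L M)
      map g := FGModuleCat.ofHom (BalancedTensor.map k A B C LinearMap.id g.hom.hom)
      map_id M := FGModuleCat.hom_ext (BalancedTensor.hom_ext k A B C fun _ _ => rfl)
      map_comp f g := FGModuleCat.hom_ext (BalancedTensor.hom_ext k A B C fun _ _ => rfl) }
  map f :=
    { app M := FGModuleCat.ofHom (BalancedTensor.map k A B C f.hom.hom LinearMap.id)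
      naturality M N g := FGModuleCat.hom_ext (BalancedTensor.hom_ext k A B C fun _ _ => rfl) }
  map_id L := by
    ext M : 2
    exact FGModuleCat.hom_ext (BalancedTensor.hom_ext k A B C fun _ _ => rfl)
  map_comp f g := by
    ext M : 2
    exact FGModuleCat.hom_ext (BalancedTensor.hom_ext k A B C fun _ _ => rfl)

instance : (tensorBimod k A B C).Additive where
  map_add {L L' f g} := by
    ext M : 2
    refine FGModuleCat.hom_ext (BalancedTensor.hom_ext k A B C fun l m => ?_)
    change BalancedTensor.mk k A B C L' M ((f.hom.hom l + g.hom.hom l) ⊗ₜ m) =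
      BalancedTensor.mk k A B C L' M (f.hom.hom l ⊗ₜ m) +
      BalancedTensor.mk k A B C L' M (g.hom.hom l ⊗ₜ m)
    rw [TensorProduct.add_tmul, map_add]

instance (L : FGBimod k A B) : ((tensorBimod k A B C).obj L).Additive where
  map_add {M M' f g} := by
    refine FGModuleCat.hom_ext (BalancedTensor.hom_ext k A B C fun l m => ?_)
    change BalancedTensor.mk k A B C L M' (l ⊗ₜ (f.hom.hom m + g.hom.hom m)) =
      BalancedTensor.mk k A B C L M' (l ⊗ₜ f.hom.hom m) +
      BalancedTensor.mk k A B C L M' (l ⊗ₜ g.hom.hom m)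
    rw [TensorProduct.tmul_add, map_add]

end Bimodules

section Complexes

/-! ### Bounded above complexes and the derived category `D⁻` -/

variable (𝒜 : Type*) [Category* 𝒜]

/-- The cochain complexes that vanish in all sufficiently large degrees. -/
def boundedAbove [HasZeroMorphisms 𝒜] : ObjectProperty (CochainComplex 𝒜 ℤ) :=
  fun K => ∃ n : ℤ, K.IsStrictlyLE n

/-- The category of bounded above cochain complexes. -/
abbrev CMinus [HasZeroMorphisms 𝒜] := (boundedAbove 𝒜).FullSubcategory

/-- The quasi-isomorphisms between bounded above complexes. -/
def qis [HasZeroMorphisms 𝒜] [CategoryWithHomology 𝒜] : MorphismProperty (CMinus 𝒜) :=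
  (HomologicalComplex.quasiIso 𝒜 (ComplexShape.up ℤ)).inverseImage (boundedAbove 𝒜).ι

instance [HasZeroMorphisms 𝒜] [CategoryWithHomology 𝒜] : (qis 𝒜).IsMultiplicative := by
  dsimp [qis]
  infer_instance

/-- The derived category of bounded above complexes: the localization of the category of
bounded above complexes at the quasi-isomorphisms. -/
abbrev DMinus [HasZeroMorphisms 𝒜] [CategoryWithHomology 𝒜] := (qis 𝒜).Localization

end Complexes

section Tensor

theorem hasCoproduct_of_finite_support {𝒜 : Type*} [Category* 𝒜] [HasZeroMorphisms 𝒜]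
    [HasFiniteCoproducts 𝒜] {ι : Type*} (X : ι → 𝒜) (s : Set ι) (hs : s.Finite)
    (h : ∀ i, i ∉ s → IsZero (X i)) : HasCoproduct X := by
  classical
  have := hs.to_subtype
  refine HasColimit.mk ⟨Cofan.mk (∐ fun i : s => X i)
    (fun i => if hi : i ∈ s then Sigma.ι (fun i : s => X i) ⟨i, hi⟩ else 0),
    Cofan.IsColimit.mk _ (fun c => Limits.Sigma.desc (f := fun i : s => X i) fun i => c.inj i.1) ?_ ?_⟩
  · intro c i
    by_cases hi : i ∈ s
    · simp [hi]
    · exact (h i hi).eq_of_src _ _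
  · intro c m hm
    refine Limits.Sigma.hom_ext (f := fun i : s => X i) _ _ fun i => ?_
    have := hm i
    simpa using this

variable {𝒜 ℬ 𝒞 : Type*} [Category* 𝒜] [Category* ℬ] [Category* 𝒞]
  [Preadditive 𝒜] [Preadditive ℬ] [Preadditive 𝒞] [HasFiniteCoproducts 𝒞]
  (F : 𝒜 ⥤ ℬ ⥤ 𝒞) [F.Additive] [∀ X, (F.obj X).Additive]

theorem isZero_bifunctor_left {X : 𝒜} (hX : IsZero X) (Y : ℬ) : IsZero ((F.obj X).obj Y) :=
  Functor.map_isZero (F.flip.obj Y) hX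

instance hasMapBifunctor (K : CMinus 𝒜) (L : CMinus ℬ) :
    HomologicalComplex.HasMapBifunctor K.obj L.obj F (ComplexShape.up ℤ) := by
  obtain ⟨n, hn⟩ := K.property
  obtain ⟨m, hm⟩ := L.property
  intro j
  refine hasCoproduct_of_finite_support _ {p | p.1.1 ≤ n ∧ p.1.2 ≤ m} ?_ ?_
  · refine Set.Finite.of_injOn (f := fun p => p.1.1) (t := Set.Icc (j - m) n) ?_ ?_
      (Set.finite_Icc _ _)
    · rintro ⟨⟨a, b⟩, h⟩ ⟨h₁, h₂⟩
      change a + b = j at h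
      dsimp at h₁ h₂ ⊢
      constructor <;> lia
    · rintro ⟨⟨a, b⟩, h⟩ _ ⟨⟨a', b'⟩, h'⟩ _ hab
      change a + b = j at h
      change a' + b' = j at h'
      dsimp at hab
      ext <;> dsimp <;> lia
  · rintro ⟨⟨a, b⟩, h⟩ hab
    change IsZero ((F.obj (K.obj.X a)).obj (L.obj.X b))
    by_cases ha : a ≤ n
    · have hb : m < b := by
        by_contra hb
        exact hab ⟨ha, not_lt.1 hb⟩
      exact Functor.map_isZero _ (L.obj.isZero_of_isStrictlyLE m b hb)
    · exact isZero_bifunctor_left F (K.obj.isZero_of_isStrictlyLE n a (not_le.1 ha)) _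

theorem boundedAbove_mapBifunctor (K : CMinus 𝒜) (L : CMinus ℬ) :
    boundedAbove 𝒞 (HomologicalComplex.mapBifunctor K.obj L.obj F (ComplexShape.up ℤ)) := by
  obtain ⟨n, hn⟩ := K.property
  obtain ⟨m, hm⟩ := L.property
  refine ⟨n + m, (CochainComplex.isStrictlyLE_iff _ _).2 fun i hi => ?_⟩
  rw [IsZero.iff_id_eq_zero]
  refine HomologicalComplex.mapBifunctor.hom_ext fun a b h => ?_
  change a + b = i at h
  refine IsZero.eq_of_src ?_ _ _
  by_cases ha : a ≤ n
  · exact Functor.map_isZero _ (L.obj.isZero_of_isStrictlyLE m b (by lia))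
  · exact isZero_bifunctor_left F (K.obj.isZero_of_isStrictlyLE n a (not_le.1 ha)) _

/-- The bifunctor on bounded above complexes induced by a biadditive bifunctor `F`: it sends
`(K, L)` to the total complex with degree `n` part `⨁_{p + q = n} F (K p) (L q)` and
differential `F (d, 1) + (-1) ^ p F (1, d)`. -/
def mapBifunctorCMinus : CMinus 𝒜 ⥤ CMinus ℬ ⥤ CMinus 𝒞 where
  obj K :=
    { obj L := ⟨HomologicalComplex.mapBifunctor K.obj L.obj F (ComplexShape.up ℤ),
        boundedAbove_mapBifunctor F K L⟩
      map g := ObjectProperty.homMk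
        (HomologicalComplex.mapBifunctorMap (𝟙 K.obj) g.hom F (ComplexShape.up ℤ))
      map_id L := by
        refine ObjectProperty.hom_ext _ (HomologicalComplex.hom_ext _ _ fun i => ?_)
        exact HomologicalComplex.mapBifunctor.hom_ext fun a b h => by dsimp; simp
      map_comp f g := by
        refine ObjectProperty.hom_ext _ (HomologicalComplex.hom_ext _ _ fun i => ?_)
        exact HomologicalComplex.mapBifunctor.hom_ext fun a b h => by dsimp; simp }
  map f :=
    { app L := ObjectProperty.homMk
        (HomologicalComplex.mapBifunctorMap f.hom (𝟙 L.obj) F (ComplexShape.up ℤ))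
      naturality L L' g := by
        refine ObjectProperty.hom_ext _ (HomologicalComplex.hom_ext _ _ fun i => ?_)
        exact HomologicalComplex.mapBifunctor.hom_ext fun a b h => by dsimp; simp }
  map_id K := by
    ext L : 2
    refine ObjectProperty.hom_ext _ (HomologicalComplex.hom_ext _ _ fun i => ?_)
    exact HomologicalComplex.mapBifunctor.hom_ext fun a b h => by dsimp; simp
  map_comp f g := by
    ext L : 2
    refine ObjectProperty.hom_ext _ (HomologicalComplex.hom_ext _ _ fun i => ?_)
    exact HomologicalComplex.mapBifunctor.hom_ext fun a b h => by dsimp; simp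

end Tensor

section DerivedTensor

variable (k A B C : Type u) [Field k] [Ring A] [Algebra k A] [Ring B] [Algebra k B]
  [Ring C] [Algebra k C]
  [FiniteDimensional k A] [FiniteDimensional k B] [FiniteDimensional k C]

/-- The derived category `D⁻(A ⊗ Bᵒᵖ)` of bounded above complexes of finitely generated
`A`-`B`-bimodules. -/
abbrev DMinusBimod := DMinus (FGBimod k A B)

/-- The bifunctor `(L, M) ↦ L ⊗_B M` on bounded above complexes of bimodules, followed by the
passage to the derived category. -/
def tensorToDerived :
    CMinus (FGBimod k A B) × CMinus (FGBimod k B C) ⥤ DMinusBimod k A C :=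
  Functor.uncurry.obj (mapBifunctorCMinus (tensorBimod k A B C)) ⋙ (qis (FGBimod k A C)).Q

/-- The existence of a total left derived functor of `⊗_B` in both variables. -/
abbrev HasDerivedTensor : Prop :=
  (tensorToDerived k A B C).HasLeftDerivedFunctor
    ((qis (FGBimod k A B)).prod (qis (FGBimod k B C)))

/-- The derived tensor product `⊗ᴸ_B`, the total left derived functor of `⊗_B`, as a bifunctor
`D⁻(A ⊗ Bᵒᵖ) × D⁻(B ⊗ Cᵒᵖ) → D⁻(A ⊗ Cᵒᵖ)`. -/
def derivedTensor [HasDerivedTensor k A B C] :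
    DMinusBimod k A B ⥤ DMinusBimod k B C ⥤ DMinusBimod k A C :=
  Functor.curry.obj ((tensorToDerived k A B C).totalLeftDerived
    ((qis (FGBimod k A B)).Q.prod (qis (FGBimod k B C)).Q)
    ((qis (FGBimod k A B)).prod (qis (FGBimod k B C))))

end DerivedTensor

end DerivedTensor

end

noncomputable section

namespace DerivedTensor

/-!
Let `P_B` be a resolution of the bimodule `B` by projective bimodules. If `X` is a projective
bimodule, a dual basis of `X` exhibits `L ⊗ X ⊗ M` as a natural direct summand of a finite sum of
copies of `L ⊗_k M`, so that `L ⊗ X` is flat on the right and `X ⊗ M` is flat on the left. Hence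
`P_B ⊗ M ⟶ M` is a functorial resolution by complexes of left flat bimodules, and
`L ⊗ (P_B ⊗ M)` computes the derived tensor product of `L` and `M`: quasi-isomorphisms in the
second variable are handled by replacing `L` with `L ⊗ P_B`, whose terms are right flat. The
associativity of the tensor product of complexes then gives
`(L ⊗ (P_B ⊗ M)) ⊗ (P_C ⊗ N) ≅ L ⊗ (P_B ⊗ (M ⊗ (P_C ⊗ N)))`, which descends to the derived
categories.
-/

section MappingCone

variable {𝒞 : Type*} [Category* 𝒞] [Abelian 𝒞] {K L : CochainComplex 𝒞 ℤ} (φ : K ⟶ L)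

/-- The pair `(x, y)` is a generalized cocycle, of degree `j`, of the mapping cone of `φ`
(with `l = j + 1`). Signs are arranged so that `x` and `y` agree in `L`. -/
structure IsConeCocycle {j l : ℤ} {A : 𝒞} (x : A ⟶ K.X l) (y : A ⟶ L.X j) : Prop where
  d_eq_zero : x ≫ K.d l (l + 1) = 0
  comp_eq_d : x ≫ φ.f l = y ≫ L.d j l

/-- After passing to an epimorphism onto `A`, the pair `(x, y)` is a coboundary of the mapping
cone of `φ` (with `j = i + 1` and `l = j + 1`). -/
def IsLocallyConeBoundary (i : ℤ) {j l : ℤ} {A : 𝒞} (x : A ⟶ K.X l) (y : A ⟶ L.X j) : Prop :=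
  ∃ (A' : 𝒞) (π : A' ⟶ A) (_ : Epi π) (x' : A' ⟶ K.X j) (y' : A' ⟶ L.X i),
    π ≫ x = x' ≫ K.d j l ∧ π ≫ y = x' ≫ φ.f j + y' ≫ L.d i j

variable {φ}

theorem IsConeCocycle.precomp_sub_boundary {i j l : ℤ} {A A' : 𝒞} {x : A ⟶ K.X l} {y : A ⟶ L.X j}
    (h : IsConeCocycle φ x y) (π : A' ⟶ A) (x' : A' ⟶ K.X j) (y' : A' ⟶ L.X i) :
    IsConeCocycle φ (π ≫ x - x' ≫ K.d j l) (π ≫ y - (x' ≫ φ.f j + y' ≫ L.d i j)) where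
  d_eq_zero := by simp [h.d_eq_zero]
  comp_eq_d := by simp [h.comp_eq_d]

theorem IsLocallyConeBoundary.of_precomp_sub_boundary {i j l : ℤ} {A A' : 𝒞} {x : A ⟶ K.X l}
    {y : A ⟶ L.X j} {π : A' ⟶ A} [Epi π] {x' : A' ⟶ K.X j} {y' : A' ⟶ L.X i}
    (h : IsLocallyConeBoundary φ i (π ≫ x - x' ≫ K.d j l)
      (π ≫ y - (x' ≫ φ.f j + y' ≫ L.d i j))) :
    IsLocallyConeBoundary φ i x y := by
  obtain ⟨A'', ρ, _, x'', y'', hx, hy⟩ := h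
  rw [Preadditive.comp_sub, sub_eq_iff_eq_add] at hx hy
  refine ⟨A'', ρ ≫ π, inferInstance, x'' + ρ ≫ x', y'' + ρ ≫ y', ?_, ?_⟩
  · simp [hx]
  · rw [Category.assoc, hy]
    simp only [Preadditive.add_comp, Preadditive.comp_add, Category.assoc]
    abel

theorem isLocallyConeBoundary_of_quasiIso [QuasiIso φ] {i j l : ℤ} (hij : i + 1 = j)
    (hjl : j + 1 = l) {A : 𝒞} {x : A ⟶ K.X l} {y : A ⟶ L.X j} (h : IsConeCocycle φ x y) :
    IsLocallyConeBoundary φ i x y := by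
  have hmono : Mono (HomologicalComplex.homologyMap φ l) := inferInstance
  have hepi : Epi (HomologicalComplex.homologyMap φ j) := inferInstance
  rw [HomologicalComplex.mono_homologyMap_iff_up_to_refinements φ j l (l + 1)
    ((ComplexShape.up ℤ).prev_eq' hjl) ((ComplexShape.up ℤ).next_eq' rfl)] at hmono
  rw [HomologicalComplex.epi_homologyMap_iff_up_to_refinements φ i j l
    ((ComplexShape.up ℤ).prev_eq' hij) ((ComplexShape.up ℤ).next_eq' hjl)] at hepi
  obtain ⟨A₁, π₁, _, x₁, hx₁⟩ := hmono x h.d_eq_zero y h.comp_eq_d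
  obtain ⟨A₂, π₂, _, x₂, hx₂, y₂, hy₂⟩ := hepi (π₁ ≫ y - x₁ ≫ φ.f j) (by
    simp only [Preadditive.sub_comp, Category.assoc, ← h.comp_eq_d, φ.comm, reassoc_of% hx₁,
      sub_self])
  refine ⟨A₂, π₂ ≫ π₁, inferInstance, π₂ ≫ x₁ + x₂, y₂, by simp [hx₁, hx₂], ?_⟩
  rw [Preadditive.comp_sub, sub_eq_iff_eq_add] at hy₂
  rw [Category.assoc, hy₂, Preadditive.add_comp, Category.assoc]
  abel

theorem quasiIso_of_isLocallyConeBoundary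
    (h : ∀ (i j l : ℤ) (_ : i + 1 = j) (_ : j + 1 = l) ⦃A : 𝒞⦄ (x : A ⟶ K.X l) (y : A ⟶ L.X j),
      IsConeCocycle φ x y → IsLocallyConeBoundary φ i x y) : QuasiIso φ := by
  rw [quasiIso_iff]
  intro j
  rw [quasiIsoAt_iff_isIso_homologyMap]
  have : Mono (HomologicalComplex.homologyMap φ j) := by
    rw [HomologicalComplex.mono_homologyMap_iff_up_to_refinements φ (j - 1) j (j + 1)
      ((ComplexShape.up ℤ).prev_eq' (sub_add_cancel j 1)) ((ComplexShape.up ℤ).next_eq' rfl)]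
    intro A x hx y hxy
    obtain ⟨A', π, hπ, x', -, hx', -⟩ := h (j - 2) (j - 1) j (by lia) (by lia) x y ⟨hx, hxy⟩
    exact ⟨A', π, hπ, x', hx'⟩
  have : Epi (HomologicalComplex.homologyMap φ j) := by
    rw [HomologicalComplex.epi_homologyMap_iff_up_to_refinements φ (j - 1) j (j + 1)
      ((ComplexShape.up ℤ).prev_eq' (sub_add_cancel j 1)) ((ComplexShape.up ℤ).next_eq' rfl)]
    intro A y hy
    obtain ⟨A', π, hπ, x', y', hx', hy'⟩ := h (j - 1) j (j + 1) (by lia) (by lia)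
      (0 : A ⟶ K.X (j + 1)) y ⟨by simp, by simp [hy]⟩
    exact ⟨A', π, hπ, x', by simpa using hx'.symm, y', hy'⟩
  exact isIso_of_mono_of_epi _

end MappingCone

section Components

variable {𝒜 ℬ 𝒞 : Type*} [Category* 𝒜] [Category* ℬ] [Category* 𝒞]
  [Preadditive 𝒜] [Preadditive ℬ] [Preadditive 𝒞] [HasFiniteCoproducts 𝒞]
  (F : 𝒜 ⥤ ℬ ⥤ 𝒞) [F.Additive] [∀ X, (F.obj X).Additive]

open HomologicalComplex

/-- The projection of the total complex in degree `n` onto its summand `F (K p) (L (n - p))`. -/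
def totalProj (K : CMinus 𝒜) (L : CMinus ℬ) (n p : ℤ) :
    (mapBifunctor K.obj L.obj F (ComplexShape.up ℤ)).X n ⟶
      (F.obj (K.obj.X p)).obj (L.obj.X (n - p)) :=
  mapBifunctorDesc fun i₁ i₂ h =>
    if e : i₁ = p then
      (F.map (K.obj.XIsoOfEq e).hom).app _ ≫
        (F.obj _).map (L.obj.XIsoOfEq (by change i₁ + i₂ = n at h; lia)).hom
    else 0

/-- The inclusion of the summand `F (K p) (L (n - p))` of the total complex in degree `n`. -/
abbrev totalIncl (K : CMinus 𝒜) (L : CMinus ℬ) (n p : ℤ) :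
    (F.obj (K.obj.X p)).obj (L.obj.X (n - p)) ⟶
      (mapBifunctor K.obj L.obj F (ComplexShape.up ℤ)).X n :=
  ιMapBifunctor K.obj L.obj F (ComplexShape.up ℤ) p (n - p) n (by change p + (n - p) = n; lia)

variable {F}

theorem ι_totalProj (K : CMinus 𝒜) (L : CMinus ℬ) (n p q : ℤ) (h : p + q = n) :
    ιMapBifunctor K.obj L.obj F (ComplexShape.up ℤ) p q n h ≫ totalProj F K L n p =
      (F.obj _).map (L.obj.XIsoOfEq (by lia)).hom := by
  simp [totalProj]

theorem ι_totalProj_of_ne (K : CMinus 𝒜) (L : CMinus ℬ) (n p p' q : ℤ) (h : p + q = n)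
    (hp : p ≠ p') :
    ιMapBifunctor K.obj L.obj F (ComplexShape.up ℤ) p q n h ≫ totalProj F K L n p' = 0 := by
  simp [totalProj, hp]

theorem totalIncl_totalProj (K : CMinus 𝒜) (L : CMinus ℬ) (n p : ℤ) :
    totalIncl F K L n p ≫ totalProj F K L n p = 𝟙 _ := by
  rw [totalIncl, ι_totalProj]
  simp

theorem exists_sum_totalProj_totalIncl (K : CMinus 𝒜) (L : CMinus ℬ) (n : ℤ) :
    ∃ s : Finset ℤ, ∑ p ∈ s, totalProj F K L n p ≫ totalIncl F K L n p = 𝟙 _ := by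
  obtain ⟨a, ha⟩ := K.property
  obtain ⟨b, hb⟩ := L.property
  refine ⟨Finset.Icc (n - b) a, mapBifunctor.hom_ext fun p q h => ?_⟩
  change p + q = n at h
  rw [Preadditive.comp_sum, Category.comp_id]
  by_cases hp : p ∈ Finset.Icc (n - b) a
  · rw [Finset.sum_eq_single_of_mem p hp]
    · obtain rfl : q = n - p := by lia
      simp [reassoc_of% ι_totalProj (F := F) K L]
    · intro p' _ hp'
      rw [reassoc_of% ι_totalProj_of_ne (F := F) K L _ _ _ _ h hp'.symm, zero_comp]
  · refine IsZero.eq_of_src ?_ _ _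
    rw [Finset.mem_Icc, not_and_or] at hp
    obtain hp | hp := hp
    · exact Functor.map_isZero _ (L.obj.isZero_of_isStrictlyLE b q (by lia))
    · exact isZero_bifunctor_left F (K.obj.isZero_of_isStrictlyLE a p (by lia)) _

theorem total_hom_ext {K : CMinus 𝒜} {L : CMinus ℬ} {n : ℤ} {A : 𝒞}
    {f g : A ⟶ (mapBifunctor K.obj L.obj F (ComplexShape.up ℤ)).X n}
    (h : ∀ p, f ≫ totalProj F K L n p = g ≫ totalProj F K L n p) : f = g := by
  obtain ⟨s, hs⟩ := exists_sum_totalProj_totalIncl (F := F) K L n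
  rw [← Category.comp_id f, ← Category.comp_id g, ← hs, Preadditive.comp_sum, Preadditive.comp_sum]
  exact Finset.sum_congr rfl fun p _ => by rw [← Category.assoc, h, Category.assoc]

theorem map_totalProj (K : CMinus 𝒜) {L L' : CMinus ℬ} (f : L ⟶ L') (n p : ℤ) :
    (mapBifunctorMap (𝟙 K.obj) f.hom F (ComplexShape.up ℤ)).f n ≫ totalProj F K L' n p =
      totalProj F K L n p ≫ (F.obj (K.obj.X p)).map (f.hom.f (n - p)) := by
  refine mapBifunctor.hom_ext fun i₁ i₂ h => ?_
  change i₁ + i₂ = n at h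
  rw [ι_mapBifunctorMap_assoc]
  by_cases hp : i₁ = p
  · subst hp
    obtain rfl : i₂ = n - i₁ := by lia
    rw [ι_totalProj, reassoc_of% ι_totalProj (F := F) K L]
    simp
  · rw [ι_totalProj_of_ne _ _ _ _ _ _ h hp, reassoc_of% ι_totalProj_of_ne (F := F) K L _ _ _ _ h hp]
    simp

theorem D₁_totalProj (K : CMinus 𝒜) (L : CMinus ℬ) (n n' p : ℤ) (hn : n + 1 = n') :
    mapBifunctor.D₁ K.obj L.obj F (ComplexShape.up ℤ) n n' ≫ totalProj F K L n' p =
      totalProj F K L n (p - 1) ≫ (F.map (K.obj.d (p - 1) p)).app _ ≫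
        (F.obj _).map (L.obj.XIsoOfEq (by lia)).hom := by
  refine mapBifunctor.hom_ext fun i₁ i₂ h => ?_
  change i₁ + i₂ = n at h
  rw [mapBifunctor.ι_D₁_assoc]
  by_cases hp : i₁ = p - 1
  · subst hp
    obtain rfl : i₂ = n - (p - 1) := by lia
    rw [reassoc_of% ι_totalProj (F := F) K L, mapBifunctor.d₁_eq _ _ _ _
        (show (ComplexShape.up ℤ).Rel (p - 1) p from sub_add_cancel p 1) _ _
        (show p + (n - (p - 1)) = n' by lia),
      Linear.units_smul_comp, Category.assoc, ι_totalProj]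
    trans (1 : ℤˣ) • ((F.map (K.obj.d (p - 1) p)).app (L.obj.X (n - (p - 1))) ≫
      (F.obj (K.obj.X p)).map (L.obj.XIsoOfEq (by lia)).hom)
    · rfl
    · simp
  · rw [mapBifunctor.d₁_eq _ _ _ _ (show (ComplexShape.up ℤ).Rel i₁ (i₁ + 1) from rfl) _ _
        (show i₁ + 1 + i₂ = n' by lia), Linear.units_smul_comp, Category.assoc,
      ι_totalProj_of_ne _ _ _ _ _ _ _ (by lia),
      reassoc_of% ι_totalProj_of_ne (F := F) K L _ _ _ _ h hp]
    simp

theorem D₂_totalProj (K : CMinus 𝒜) (L : CMinus ℬ) (n n' p : ℤ) (hn : n + 1 = n') :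
    mapBifunctor.D₂ K.obj L.obj F (ComplexShape.up ℤ) n n' ≫ totalProj F K L n' p =
      p.negOnePow • totalProj F K L n p ≫ (F.obj (K.obj.X p)).map (L.obj.d (n - p) (n' - p)) := by
  refine mapBifunctor.hom_ext fun i₁ i₂ h => ?_
  change i₁ + i₂ = n at h
  rw [mapBifunctor.ι_D₂_assoc, Linear.comp_units_smul]
  by_cases hp : i₁ = p
  · subst hp
    obtain rfl : i₂ = n - i₁ := by lia
    rw [reassoc_of% ι_totalProj (F := F) K L, mapBifunctor.d₂_eq _ _ _ _ _
        (show (ComplexShape.up ℤ).Rel (n - i₁) (n' - i₁) by change n - i₁ + 1 = n' - i₁; lia) _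
        (show i₁ + (n' - i₁) = n' by lia),
      Linear.units_smul_comp, Category.assoc, ι_totalProj]
    trans i₁.negOnePow • ((F.obj (K.obj.X i₁)).map (L.obj.d (n - i₁) (n' - i₁)) ≫
      (F.obj (K.obj.X i₁)).map (L.obj.XIsoOfEq rfl).hom)
    · rfl
    · simp
  · rw [mapBifunctor.d₂_eq _ _ _ _ _ (show (ComplexShape.up ℤ).Rel i₂ (i₂ + 1) from rfl) _
        (show i₁ + (i₂ + 1) = n' by lia), Linear.units_smul_comp, Category.assoc,
      ι_totalProj_of_ne _ _ _ _ _ _ _ hp, reassoc_of% ι_totalProj_of_ne (F := F) K L _ _ _ _ h hp]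
    simp

theorem d_totalProj (K : CMinus 𝒜) (L : CMinus ℬ) (n n' p : ℤ) (hn : n + 1 = n') :
    (mapBifunctor K.obj L.obj F (ComplexShape.up ℤ)).d n n' ≫ totalProj F K L n' p =
      totalProj F K L n (p - 1) ≫ (F.map (K.obj.d (p - 1) p)).app _ ≫
          (F.obj _).map (L.obj.XIsoOfEq (by lia)).hom +
        p.negOnePow • totalProj F K L n p ≫
          (F.obj (K.obj.X p)).map (L.obj.d (n - p) (n' - p)) := by
  rw [mapBifunctor.d_eq, Preadditive.add_comp, D₁_totalProj _ _ _ _ _ hn,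
    D₂_totalProj _ _ _ _ _ hn]

end Components

section Columns

open HomologicalComplex

variable {𝒜 ℬ 𝒞 : Type*} [Category* 𝒜] [Category* ℬ] [Category* 𝒞]
  [Preadditive 𝒜] [Preadditive ℬ] [Preadditive 𝒞] [HasFiniteCoproducts 𝒞]
  {F : 𝒜 ⥤ ℬ ⥤ 𝒞} [F.Additive] [∀ X, (F.obj X).Additive] {K : CMinus 𝒜} {L L' : CMinus ℬ}

/-- The generalized element `x` of the total complex of `F (K, L)` lies in the `p`-th step of the
column filtration, the sum of the `F (K p', L q)` with `p ≤ p'`. -/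
def VanishesBelow (p : ℤ) {n : ℤ} {A : 𝒞}
    (x : A ⟶ (mapBifunctor K.obj L.obj F (ComplexShape.up ℤ)).X n) : Prop :=
  ∀ p' < p, x ≫ totalProj F K L n p' = 0

theorem vanishesBelow_of_isStrictlyLE (L : CMinus ℬ) {n b p : ℤ} [L.obj.IsStrictlyLE b]
    (hp : p ≤ n - b) {A : 𝒞} (x : A ⟶ (mapBifunctor K.obj L.obj F (ComplexShape.up ℤ)).X n) :
    VanishesBelow p x :=
  fun _ hp' =>
    (Functor.map_isZero _ (L.obj.isZero_of_isStrictlyLE b _ (by lia))).eq_of_tgt _ _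

theorem VanishesBelow.eq_zero {n a : ℤ} [K.obj.IsStrictlyLE a] {A : 𝒞}
    {x : A ⟶ (mapBifunctor K.obj L.obj F (ComplexShape.up ℤ)).X n}
    (hx : VanishesBelow (a + 1) x) : x = 0 :=
  total_hom_ext fun p => by
    rw [zero_comp]
    by_cases hp : p < a + 1
    · exact hx p hp
    · exact (isZero_bifunctor_left F (K.obj.isZero_of_isStrictlyLE a p (by lia)) _).eq_of_tgt _ _

theorem VanishesBelow.comp_d_totalProj {n n' p : ℤ} (hn : n + 1 = n') {A : 𝒞}
    {x : A ⟶ (mapBifunctor K.obj L.obj F (ComplexShape.up ℤ)).X n} (hx : VanishesBelow p x) :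
    x ≫ (mapBifunctor K.obj L.obj F (ComplexShape.up ℤ)).d n n' ≫ totalProj F K L n' p =
      p.negOnePow • (x ≫ totalProj F K L n p) ≫
        (F.obj (K.obj.X p)).map (L.obj.d (n - p) (n' - p)) := by
  rw [d_totalProj _ _ _ _ _ hn, Preadditive.comp_add, ← Category.assoc x,
    hx (p - 1) (by lia), zero_comp, zero_add, Linear.comp_units_smul, Category.assoc]

theorem VanishesBelow.comp_d {n n' p : ℤ} (hn : n + 1 = n') {A : 𝒞}
    {x : A ⟶ (mapBifunctor K.obj L.obj F (ComplexShape.up ℤ)).X n} (hx : VanishesBelow p x) :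
    VanishesBelow p (x ≫ (mapBifunctor K.obj L.obj F (ComplexShape.up ℤ)).d n n') := by
  intro p' hp'
  have hx' : VanishesBelow p' x := fun p'' h => hx p'' (h.trans hp')
  rw [Category.assoc, hx'.comp_d_totalProj hn, hx p' hp', zero_comp, smul_zero]

theorem VanishesBelow.comp_map {n p : ℤ} {A : 𝒞}
    {x : A ⟶ (mapBifunctor K.obj L.obj F (ComplexShape.up ℤ)).X n} (hx : VanishesBelow p x)
    (f : L ⟶ L') :
    VanishesBelow p (x ≫ (mapBifunctorMap (𝟙 K.obj) f.hom F (ComplexShape.up ℤ)).f n) :=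
  fun p' hp' => by rw [Category.assoc, map_totalProj, ← Category.assoc, hx p' hp', zero_comp]

theorem VanishesBelow.add {n p : ℤ} {A : 𝒞}
    {x y : A ⟶ (mapBifunctor K.obj L.obj F (ComplexShape.up ℤ)).X n} (hx : VanishesBelow p x)
    (hy : VanishesBelow p y) : VanishesBelow p (x + y) :=
  fun p' hp' => by rw [Preadditive.add_comp, hx p' hp', hy p' hp', add_zero]

theorem VanishesBelow.precomp_sub {n p : ℤ} {A A' : 𝒞} {π : A' ⟶ A}
    {x : A ⟶ (mapBifunctor K.obj L.obj F (ComplexShape.up ℤ)).X n}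
    {y : A' ⟶ (mapBifunctor K.obj L.obj F (ComplexShape.up ℤ)).X n}
    (hx : VanishesBelow p x) (hy : VanishesBelow p y)
    (h : π ≫ x ≫ totalProj F K L n p = y ≫ totalProj F K L n p) :
    VanishesBelow (p + 1) (π ≫ x - y) := by
  intro p' hp'
  rw [Preadditive.sub_comp, Category.assoc, sub_eq_zero]
  obtain hp' | rfl : p' < p ∨ p' = p := by lia
  · rw [hx p' hp', hy p' hp', comp_zero]
  · exact h

theorem vanishesBelow_comp_totalIncl {n p : ℤ} {A : 𝒞}
    (z : A ⟶ (F.obj (K.obj.X p)).obj (L.obj.X (n - p))) :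
    VanishesBelow p (z ≫ totalIncl F K L n p) :=
  fun p' hp' => by rw [Category.assoc, ι_totalProj_of_ne _ _ _ _ _ _ _ hp'.ne', comp_zero]

end Columns

section TotalQuasiIso

open HomologicalComplex

variable {𝒜 ℬ 𝒞 : Type*} [Category* 𝒜] [Category* ℬ] [Category* 𝒞]
  [Preadditive 𝒜] [Preadditive ℬ] [Abelian 𝒞]
  {F : 𝒜 ⥤ ℬ ⥤ 𝒞} [F.Additive] [∀ X, (F.obj X).Additive]

theorem IsConeCocycle.comp_totalProj {K : CMinus 𝒜} {L L' : CMinus ℬ} {f : L ⟶ L'} {j l p : ℤ}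
    (hjl : j + 1 = l) {A : 𝒞} {x : A ⟶ (mapBifunctor K.obj L.obj F (ComplexShape.up ℤ)).X l}
    {y : A ⟶ (mapBifunctor K.obj L'.obj F (ComplexShape.up ℤ)).X j}
    (h : IsConeCocycle (mapBifunctorMap (𝟙 K.obj) f.hom F (ComplexShape.up ℤ)) x y)
    (hx : VanishesBelow p x) (hy : VanishesBelow p y) :
    IsConeCocycle (((F.obj (K.obj.X p)).mapHomologicalComplex (ComplexShape.up ℤ)).map f.hom)
      (j := j - p) (l := l - p) (x ≫ totalProj F K L l p)
      (p.negOnePow • y ≫ totalProj F K L' j p) where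
  d_eq_zero := by
    have := congr($(h.d_eq_zero) ≫ totalProj F K L (l + 1) p)
    rw [Category.assoc, hx.comp_d_totalProj rfl, zero_comp, smul_eq_zero_iff_eq,
      show l + 1 - p = l - p + 1 by lia] at this
    exact this
  comp_eq_d := by
    have := congr($(h.comp_eq_d) ≫ totalProj F K L' l p)
    rw [Category.assoc, Category.assoc, hy.comp_d_totalProj hjl, map_totalProj,
      ← Category.assoc x] at this
    exact this.trans (Linear.units_smul_comp ..).symm

theorem exists_sub_boundary_vanishesBelow {K : CMinus 𝒜} {L L' : CMinus ℬ} {f : L ⟶ L'}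
    {i j l p : ℤ} (hij : i + 1 = j) (hjl : j + 1 = l)
    (hf : QuasiIso (((F.obj (K.obj.X p)).mapHomologicalComplex (ComplexShape.up ℤ)).map f.hom))
    {A : 𝒞} {x : A ⟶ (mapBifunctor K.obj L.obj F (ComplexShape.up ℤ)).X l}
    {y : A ⟶ (mapBifunctor K.obj L'.obj F (ComplexShape.up ℤ)).X j}
    (h : IsConeCocycle (mapBifunctorMap (𝟙 K.obj) f.hom F (ComplexShape.up ℤ)) x y)
    (hx : VanishesBelow p x) (hy : VanishesBelow p y) :
    ∃ (A' : 𝒞) (π : A' ⟶ A) (_ : Epi π)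
      (x' : A' ⟶ (mapBifunctor K.obj L.obj F (ComplexShape.up ℤ)).X j)
      (y' : A' ⟶ (mapBifunctor K.obj L'.obj F (ComplexShape.up ℤ)).X i),
      VanishesBelow (p + 1) (π ≫ x - x' ≫ (mapBifunctor K.obj L.obj F _).d j l) ∧
      VanishesBelow (p + 1) (π ≫ y - (x' ≫ (mapBifunctorMap (𝟙 K.obj) f.hom F _).f j +
        y' ≫ (mapBifunctor K.obj L'.obj F _).d i j)) := by
  obtain ⟨A', π, hπ, x₁, y₁, hx₁, hy₁⟩ := isLocallyConeBoundary_of_quasiIso (i := i - p)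
    (by lia) (by lia) (h.comp_totalProj hjl hx hy)
  change A' ⟶ (F.obj (K.obj.X p)).obj (L.obj.X (j - p)) at x₁
  change A' ⟶ (F.obj (K.obj.X p)).obj (L'.obj.X (i - p)) at y₁
  change _ = x₁ ≫ (F.obj (K.obj.X p)).map (L.obj.d (j - p) (l - p)) at hx₁
  replace hy₁ : p.negOnePow • (π ≫ y ≫ totalProj F K L' j p) =
      x₁ ≫ (F.obj (K.obj.X p)).map (f.hom.f (j - p)) +
        y₁ ≫ (F.obj (K.obj.X p)).map (L'.obj.d (i - p) (j - p)) :=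
    (Linear.comp_units_smul ..).symm.trans hy₁
  let x' := (p.negOnePow • x₁) ≫ totalIncl F K L j p
  let y' := y₁ ≫ totalIncl F K L' i p
  have hx' : VanishesBelow p x' := vanishesBelow_comp_totalIncl _
  have hy' : VanishesBelow p y' := vanishesBelow_comp_totalIncl _
  have hx'p : x' ≫ totalProj F K L j p = p.negOnePow • x₁ := by
    rw [Category.assoc (p.negOnePow • x₁), totalIncl_totalProj, Category.comp_id]
  have hy'p : y' ≫ totalProj F K L' i p = y₁ := by
    rw [Category.assoc y₁, totalIncl_totalProj, Category.comp_id]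
  clear_value x' y'
  refine ⟨A', π, hπ, x', y', hx.precomp_sub (hx'.comp_d hjl) ?_,
    hy.precomp_sub ((hx'.comp_map f).add (hy'.comp_d hij)) ?_⟩
  · rw [Category.assoc, hx'.comp_d_totalProj hjl, hx'p, Linear.units_smul_comp, smul_smul,
      Int.units_mul_self, one_smul]
    exact hx₁
  · rw [Preadditive.add_comp, Category.assoc, Category.assoc, map_totalProj, reassoc_of% hx'p,
      hy'.comp_d_totalProj hij, hy'p, Linear.units_smul_comp, ← smul_add]
    rw [← hy₁, smul_smul, Int.units_mul_self, one_smul]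

theorem isLocallyConeBoundary_of_columns {K : CMinus 𝒜} {L L' : CMinus ℬ} {f : L ⟶ L'}
    (hf : ∀ p,
      QuasiIso (((F.obj (K.obj.X p)).mapHomologicalComplex (ComplexShape.up ℤ)).map f.hom))
    {a : ℤ} [K.obj.IsStrictlyLE a] {i j l : ℤ} (hij : i + 1 = j) (hjl : j + 1 = l) (r : ℕ) :
    ∀ {p : ℤ} (_ : a + 1 - r ≤ p) {A : 𝒞}
      {x : A ⟶ (mapBifunctor K.obj L.obj F (ComplexShape.up ℤ)).X l}
      {y : A ⟶ (mapBifunctor K.obj L'.obj F (ComplexShape.up ℤ)).X j},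
      IsConeCocycle (mapBifunctorMap (𝟙 K.obj) f.hom F (ComplexShape.up ℤ)) x y →
      VanishesBelow p x → VanishesBelow p y →
      IsLocallyConeBoundary (mapBifunctorMap (𝟙 K.obj) f.hom F (ComplexShape.up ℤ)) i x y := by
  induction r with
  | zero =>
    intro p hp A x y _ hx hy
    replace hp : a + 1 ≤ p := by simpa using hp
    rw [VanishesBelow.eq_zero (a := a) fun p' _ => hx p' (by lia),
      VanishesBelow.eq_zero (a := a) fun p' _ => hy p' (by lia)]
    exact ⟨A, 𝟙 A, inferInstance, 0, 0, by simp, by simp⟩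
  | succ r ih =>
    intro p hp A x y h hx hy
    obtain ⟨A', π, _, x', y', hx', hy'⟩ :=
      exists_sub_boundary_vanishesBelow hij hjl (hf p) h hx hy
    exact .of_precomp_sub_boundary
      (ih (by push_cast at hp; lia) (h.precomp_sub_boundary π x' y') hx' hy')

theorem quasiIso_mapBifunctorMap_of_columns (K : CMinus 𝒜) {L L' : CMinus ℬ} (f : L ⟶ L')
    (hf : ∀ p,
      QuasiIso (((F.obj (K.obj.X p)).mapHomologicalComplex (ComplexShape.up ℤ)).map f.hom)) :
    QuasiIso (mapBifunctorMap (𝟙 K.obj) f.hom F (ComplexShape.up ℤ)) := by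
  obtain ⟨a, ha⟩ := K.property
  obtain ⟨b, hb⟩ := L.property
  obtain ⟨b', hb'⟩ := L'.property
  refine quasiIso_of_isLocallyConeBoundary fun i j l hij hjl A x y h => ?_
  let p := min (l - b) (j - b')
  have hp : a + 1 - ((a + 1 - p).toNat : ℤ) ≤ p := by lia
  exact isLocallyConeBoundary_of_columns hf hij hjl (a + 1 - p).toNat hp h
    (vanishesBelow_of_isStrictlyLE L (min_le_left _ _) x)
    (vanishesBelow_of_isStrictlyLE L' (min_le_right _ _) y)

instance (Y : ℬ) : (F.flip.obj Y).Additive where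
  map_add := by intros; simp

instance : F.flip.Additive where
  map_add := by intros; ext; simp

variable (F) in
theorem quasiIso_mapBifunctorMap_flip_iff {K K' : CMinus 𝒜} (f : K ⟶ K') {L L' : CMinus ℬ}
    (g : L ⟶ L') :
    QuasiIso (mapBifunctorMap g.hom f.hom F.flip (ComplexShape.up ℤ)) ↔
      QuasiIso (mapBifunctorMap f.hom g.hom F (ComplexShape.up ℤ)) := by
  rw [← quasiIso_iff_comp_left (mapBifunctorFlipIso K.obj L.obj F (ComplexShape.up ℤ)).hom,
    ← mapBifunctorFlipIso_hom_naturality, quasiIso_iff_comp_right]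

theorem quasiIso_mapBifunctorMap_of_rows {K K' : CMinus 𝒜} (f : K ⟶ K') (L : CMinus ℬ)
    (hf : ∀ q, QuasiIso
      (((F.flip.obj (L.obj.X q)).mapHomologicalComplex (ComplexShape.up ℤ)).map f.hom)) :
    QuasiIso (mapBifunctorMap f.hom (𝟙 L.obj) F (ComplexShape.up ℤ)) :=
  (quasiIso_mapBifunctorMap_flip_iff F f (𝟙 L)).1 (quasiIso_mapBifunctorMap_of_columns L f hf)

end TotalQuasiIso

section Balance

open HomologicalComplex

variable {𝒜 ℬ 𝒞 : Type*} [Category* 𝒜] [Category* ℬ] [Category* 𝒞]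
  [Abelian 𝒜] [Abelian ℬ] [Abelian 𝒞]
  {F : 𝒜 ⥤ ℬ ⥤ 𝒞} [F.Additive] [∀ X, (F.obj X).Additive]

theorem quasiIso_mapBifunctorMap_of_exact_columns (K : CMinus 𝒜)
    [∀ p, (F.obj (K.obj.X p)).PreservesHomology] {L L' : CMinus ℬ} (f : L ⟶ L')
    [QuasiIso f.hom] : QuasiIso (mapBifunctorMap (𝟙 K.obj) f.hom F (ComplexShape.up ℤ)) :=
  quasiIso_mapBifunctorMap_of_columns K f fun _ => inferInstance

theorem quasiIso_mapBifunctorMap_of_exact_rows {K K' : CMinus 𝒜} (f : K ⟶ K') [QuasiIso f.hom]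
    (L : CMinus ℬ) [∀ q, (F.flip.obj (L.obj.X q)).PreservesHomology] :
    QuasiIso (mapBifunctorMap f.hom (𝟙 L.obj) F (ComplexShape.up ℤ)) :=
  quasiIso_mapBifunctorMap_of_rows f L fun _ => inferInstance

theorem quasiIso_mapBifunctorMap_of_quasiIso_left {K K' : CMinus 𝒜} (k : K' ⟶ K)
    [QuasiIso k.hom] [∀ p, (F.obj (K'.obj.X p)).PreservesHomology] {L L' : CMinus ℬ}
    [∀ q, (F.flip.obj (L.obj.X q)).PreservesHomology]
    [∀ q, (F.flip.obj (L'.obj.X q)).PreservesHomology] (f : L ⟶ L') [QuasiIso f.hom] :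
    QuasiIso (mapBifunctorMap (𝟙 K.obj) f.hom F (ComplexShape.up ℤ)) := by
  have hkL := quasiIso_mapBifunctorMap_of_exact_rows (F := F) k L
  have hkL' := quasiIso_mapBifunctorMap_of_exact_rows (F := F) k L'
  have hK'f := quasiIso_mapBifunctorMap_of_exact_columns (F := F) K' f
  have comm : mapBifunctorMap k.hom (𝟙 L.obj) F (ComplexShape.up ℤ) ≫
        mapBifunctorMap (𝟙 K.obj) f.hom F (ComplexShape.up ℤ) =
      mapBifunctorMap (𝟙 K'.obj) f.hom F (ComplexShape.up ℤ) ≫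
        mapBifunctorMap k.hom (𝟙 L'.obj) F (ComplexShape.up ℤ) :=
    congr($(((mapBifunctorCMinus F).map k).naturality f).hom).symm
  rw [← quasiIso_iff_comp_left (mapBifunctorMap k.hom (𝟙 L.obj) F (ComplexShape.up ℤ)), comm]
  infer_instance

theorem quasiIso_mapBifunctorMap_of_quasiIso_right {K K' : CMinus 𝒜}
    [∀ p, (F.obj (K.obj.X p)).PreservesHomology] [∀ p, (F.obj (K'.obj.X p)).PreservesHomology]
    (f : K ⟶ K') [QuasiIso f.hom] {L L' : CMinus ℬ} (l : L' ⟶ L) [QuasiIso l.hom]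
    [∀ q, (F.flip.obj (L'.obj.X q)).PreservesHomology] :
    QuasiIso (mapBifunctorMap f.hom (𝟙 L.obj) F (ComplexShape.up ℤ)) :=
  have (p : ℤ) : (F.flip.flip.obj (K.obj.X p)).PreservesHomology :=
    inferInstanceAs (F.obj (K.obj.X p)).PreservesHomology
  have (p : ℤ) : (F.flip.flip.obj (K'.obj.X p)).PreservesHomology :=
    inferInstanceAs (F.obj (K'.obj.X p)).PreservesHomology
  (quasiIso_mapBifunctorMap_flip_iff F f (𝟙 L)).1
    (quasiIso_mapBifunctorMap_of_quasiIso_left (F := F.flip) l f)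

end Balance

section FiniteSupport

theorem sum_sigma_π_ι {𝒜 ι : Type*} [Category* 𝒜] [Preadditive 𝒜] [DecidableEq ι] (X : ι → 𝒜)
    [HasCoproduct X] (s : Finset ι) (h : ∀ i ∉ s, IsZero (X i)) :
    ∑ i ∈ s, Sigma.π X i ≫ Sigma.ι X i = 𝟙 (∐ X) := by
  refine Limits.Sigma.hom_ext _ _ fun j => ?_
  rw [Preadditive.comp_sum, Category.comp_id]
  by_cases hj : j ∈ s
  · rw [Finset.sum_eq_single_of_mem j hj, Sigma.ι_π_eq_id_assoc]
    intro i _ hi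
    rw [Sigma.ι_π_of_ne_assoc _ hi.symm, zero_comp]
  · exact (h j hj).eq_of_src _ _

theorem sigmaComparison_map_π {𝒜 ℬ ι : Type*} [Category* 𝒜] [Category* ℬ] [HasZeroMorphisms 𝒜]
    [HasZeroMorphisms ℬ] [DecidableEq ι] (H : 𝒜 ⥤ ℬ) [H.PreservesZeroMorphisms] (X : ι → 𝒜)
    [HasCoproduct X] [HasCoproduct fun i => H.obj (X i)] (i : ι) :
    sigmaComparison H X ≫ H.map (Sigma.π X i) = Sigma.π (fun i => H.obj (X i)) i := by
  refine Limits.Sigma.hom_ext _ _ fun j => ?_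
  rw [ι_comp_sigmaComparison_assoc, ← H.map_comp]
  obtain rfl | hj := eq_or_ne j i
  · rw [Sigma.ι_π_eq_id, Sigma.ι_π_eq_id, H.map_id]
  · rw [Sigma.ι_π_of_ne _ hj, Sigma.ι_π_of_ne _ hj, H.map_zero]

theorem preservesColimit_of_finite_support {𝒜 ℬ ι : Type*} [Category* 𝒜] [Category* ℬ]
    [Preadditive 𝒜] [Preadditive ℬ] [HasFiniteCoproducts 𝒜] [HasFiniteCoproducts ℬ] (H : 𝒜 ⥤ ℬ)
    [H.Additive] (X : ι → 𝒜) (s : Finset ι) (h : ∀ i ∉ s, IsZero (X i)) :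
    PreservesColimit (Discrete.functor X) H := by
  classical
  have hH (i : ι) (hi : i ∉ s) : IsZero (H.obj (X i)) := H.map_isZero (h i hi)
  have := hasCoproduct_of_finite_support X s s.finite_toSet h
  have := hasCoproduct_of_finite_support (fun i => H.obj (X i)) s s.finite_toSet hH
  have : IsIso (sigmaComparison H X) := by
    refine ⟨∑ i ∈ s, H.map (Sigma.π X i) ≫ Sigma.ι (fun i => H.obj (X i)) i, ?_, ?_⟩
    · simp_rw [Preadditive.comp_sum, ← Category.assoc, sigmaComparison_map_π]
      exact sum_sigma_π_ι _ s hH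
    · simp_rw [Preadditive.sum_comp, Category.assoc, ι_comp_sigmaComparison, ← H.map_comp]
      rw [← H.map_sum, sum_sigma_π_ι X s h, H.map_id]
  exact PreservesCoproduct.of_iso_comparison H X

theorem exists_finset_isZero_bifunctor {𝒜 ℬ 𝒞 : Type*} [Category* 𝒜] [Category* ℬ] [Category* 𝒞]
    [Preadditive 𝒜] [Preadditive ℬ] [Preadditive 𝒞] [HasFiniteCoproducts 𝒞]
    (F : 𝒜 ⥤ ℬ ⥤ 𝒞) [F.Additive] [∀ X, (F.obj X).Additive] (K : CMinus 𝒜) (L : CMinus ℬ) (n : ℤ) :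
    ∃ s : Finset
        (ComplexShape.π (ComplexShape.up ℤ) (ComplexShape.up ℤ) (ComplexShape.up ℤ) ⁻¹' {n}),
      ∀ i ∉ s, IsZero ((F.obj (K.obj.X i.1.1)).obj (L.obj.X i.1.2)) := by
  classical
  obtain ⟨a, ha⟩ := K.property
  obtain ⟨b, hb⟩ := L.property
  refine ⟨(Finset.Icc (n - b) a).image fun p => ⟨(p, n - p), add_sub_cancel p n⟩, ?_⟩
  rintro ⟨⟨p, q⟩, h⟩ hpq
  change p + q = n at h
  obtain rfl : q = n - p := by lia
  have hp : p ∉ Finset.Icc (n - b) a := fun hp => hpq (Finset.mem_image_of_mem _ hp)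
  rw [Finset.mem_Icc, not_and_or] at hp
  obtain hp | hp := hp
  · exact Functor.map_isZero _ (L.obj.isZero_of_isStrictlyLE b _ (by lia))
  · exact isZero_bifunctor_left F (K.obj.isZero_of_isStrictlyLE a p (by lia)) _

end FiniteSupport

section TrifunctorComponents

variable {C₁ C₂ C₃ C₁₂ C₂₃ C₄ : Type*} [Category* C₁] [Category* C₂] [Category* C₃]
  [Category* C₁₂] [Category* C₂₃] [Category* C₄]
  {F₁₂ : C₁ ⥤ C₂ ⥤ C₁₂} {G : C₁₂ ⥤ C₃ ⥤ C₄} {F : C₁ ⥤ C₂₃ ⥤ C₄} {G₂₃ : C₂ ⥤ C₃ ⥤ C₂₃}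

/-- The components of an isomorphism `bifunctorComp₁₂ F₁₂ G ≅ bifunctorComp₂₃ F G₂₃`. -/
abbrev trifunctorComponent (a : bifunctorComp₁₂ F₁₂ G ≅ bifunctorComp₂₃ F G₂₃)
    (X₁ : C₁) (X₂ : C₂) (X₃ : C₃) :
    (G.obj ((F₁₂.obj X₁).obj X₂)).obj X₃ ⟶ (F.obj X₁).obj ((G₂₃.obj X₂).obj X₃) :=
  ((a.hom.app X₁).app X₂).app X₃

theorem trifunctorComponent_naturality (a : bifunctorComp₁₂ F₁₂ G ≅ bifunctorComp₂₃ F G₂₃)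
    {X₁ X₁' : C₁} {X₂ X₂' : C₂} {X₃ X₃' : C₃} (f₁ : X₁ ⟶ X₁') (f₂ : X₂ ⟶ X₂') (f₃ : X₃ ⟶ X₃') :
    (G.map ((F₁₂.map f₁).app X₂ ≫ (F₁₂.obj X₁').map f₂)).app X₃ ≫ (G.obj _).map f₃ ≫
        trifunctorComponent a X₁' X₂' X₃' =
      trifunctorComponent a X₁ X₂ X₃ ≫ (F.map f₁).app _ ≫
        (F.obj X₁').map ((G₂₃.map f₂).app X₃ ≫ (G₂₃.obj X₂').map f₃) := by
  have n₁ : (G.map ((F₁₂.map f₁).app X₂)).app X₃ ≫ trifunctorComponent a X₁' X₂ X₃ =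
      trifunctorComponent a X₁ X₂ X₃ ≫ (F.map f₁).app _ :=
    NatTrans.naturality_app_app a.hom f₁ X₂ X₃
  have n₂ : (G.map ((F₁₂.obj X₁').map f₂)).app X₃ ≫ trifunctorComponent a X₁' X₂' X₃ =
      trifunctorComponent a X₁' X₂ X₃ ≫ (F.obj X₁').map ((G₂₃.map f₂).app X₃) :=
    NatTrans.naturality_app (a.hom.app X₁') X₃ f₂
  have n₃ : (G.obj ((F₁₂.obj X₁').obj X₂')).map f₃ ≫ trifunctorComponent a X₁' X₂' X₃' =
      trifunctorComponent a X₁' X₂' X₃ ≫ (F.obj X₁').map ((G₂₃.obj X₂').map f₃) :=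
    NatTrans.naturality ((a.hom.app X₁').app X₂') f₃
  rw [n₃, Functor.map_comp, NatTrans.comp_app, Functor.map_comp, Category.assoc,
    reassoc_of% n₂, reassoc_of% n₁]

end TrifunctorComponents

section Associator

open HomologicalComplex

variable {C₁ C₂ C₃ C₁₂ C₂₃ C₄ : Type*} [Category* C₁] [Category* C₂] [Category* C₃]
  [Category* C₁₂] [Category* C₂₃] [Category* C₄]
  [Preadditive C₁] [Preadditive C₂] [Preadditive C₃]
  [Preadditive C₁₂] [Preadditive C₂₃] [Preadditive C₄]
  [HasFiniteCoproducts C₁₂] [HasFiniteCoproducts C₂₃] [HasFiniteCoproducts C₄]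
  {F₁₂ : C₁ ⥤ C₂ ⥤ C₁₂} {G : C₁₂ ⥤ C₃ ⥤ C₄} {F : C₁ ⥤ C₂₃ ⥤ C₄} {G₂₃ : C₂ ⥤ C₃ ⥤ C₂₃}
  [F₁₂.Additive] [∀ X, (F₁₂.obj X).Additive] [G.Additive] [∀ X, (G.obj X).Additive]
  [F.Additive] [∀ X, (F.obj X).Additive] [G₂₃.Additive] [∀ X, (G₂₃.obj X).Additive]

instance hasGoodTrifunctor₁₂ (K₁ : CMinus C₁) (K₂ : CMinus C₂) (K₃ : CMinus C₃) :
    HasGoodTrifunctor₁₂Obj F₁₂ G K₁.obj K₂.obj K₃.obj (ComplexShape.up ℤ) (ComplexShape.up ℤ) := by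
  intro n i₃
  obtain ⟨s, h⟩ := exists_finset_isZero_bifunctor F₁₂ K₁ K₂ n
  have : (G.flip.obj (K₃.obj.X i₃)).Additive := ⟨by intros; simp⟩
  exact preservesColimit_of_finite_support _ _ s h

instance hasGoodTrifunctor₂₃ (K₁ : CMinus C₁) (K₂ : CMinus C₂) (K₃ : CMinus C₃) :
    HasGoodTrifunctor₂₃Obj F G₂₃ K₁.obj K₂.obj K₃.obj (ComplexShape.up ℤ) (ComplexShape.up ℤ)
      (ComplexShape.up ℤ) := by
  intro i₁ n
  obtain ⟨s, h⟩ := exists_finset_isZero_bifunctor G₂₃ K₂ K₃ n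
  exact preservesColimit_of_finite_support _ _ s h

instance hasMapBifunctor_mapBifunctor_left (K₁ : CMinus C₁) (K₂ : CMinus C₂) (K₃ : CMinus C₃) :
    HasMapBifunctor (mapBifunctor K₁.obj K₂.obj F₁₂ (ComplexShape.up ℤ)) K₃.obj G
      (ComplexShape.up ℤ) :=
  hasMapBifunctor G (((mapBifunctorCMinus F₁₂).obj K₁).obj K₂) K₃

instance hasMapBifunctor_mapBifunctor_right (K₁ : CMinus C₁) (K₂ : CMinus C₂) (K₃ : CMinus C₃) :
    HasMapBifunctor K₁.obj (mapBifunctor K₂.obj K₃.obj G₂₃ (ComplexShape.up ℤ)) F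
      (ComplexShape.up ℤ) :=
  hasMapBifunctor F K₁ (((mapBifunctorCMinus G₂₃).obj K₂).obj K₃)

/-- The associativity isomorphism for three bounded above complexes. -/
def associatorCMinusApp (a : bifunctorComp₁₂ F₁₂ G ≅ bifunctorComp₂₃ F G₂₃)
    (K₁ : CMinus C₁) (K₂ : CMinus C₂) (K₃ : CMinus C₃) :
    ((mapBifunctorCMinus G).obj (((mapBifunctorCMinus F₁₂).obj K₁).obj K₂)).obj K₃ ≅
      ((mapBifunctorCMinus F).obj K₁).obj (((mapBifunctorCMinus G₂₃).obj K₂).obj K₃) :=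
  (boundedAbove C₄).isoMk (mapBifunctorAssociator a K₁.obj K₂.obj K₃.obj (ComplexShape.up ℤ)
    (ComplexShape.up ℤ) (ComplexShape.up ℤ))

theorem ι_mapBifunctorMap₁₂ {K₁ K₁' : CMinus C₁} {K₂ K₂' : CMinus C₂} {K₃ K₃' : CMinus C₃}
    (f₁ : K₁.obj ⟶ K₁'.obj) (f₂ : K₂.obj ⟶ K₂'.obj) (f₃ : K₃.obj ⟶ K₃'.obj)
    (i₁ i₂ i₃ j : ℤ)
    (h : ComplexShape.r (ComplexShape.up ℤ) (ComplexShape.up ℤ) (ComplexShape.up ℤ)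
      (ComplexShape.up ℤ) (ComplexShape.up ℤ) (i₁, i₂, i₃) = j) :
    mapBifunctor₁₂.ι F₁₂ G K₁.obj K₂.obj K₃.obj (ComplexShape.up ℤ) (ComplexShape.up ℤ)
        i₁ i₂ i₃ j h ≫
      (mapBifunctorMap (mapBifunctorMap f₁ f₂ F₁₂ (ComplexShape.up ℤ)) f₃ G
        (ComplexShape.up ℤ)).f j =
    (G.map ((F₁₂.map (f₁.f i₁)).app (K₂.obj.X i₂) ≫ (F₁₂.obj (K₁'.obj.X i₁)).map (f₂.f i₂))).app
        (K₃.obj.X i₃) ≫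
      (G.obj ((F₁₂.obj (K₁'.obj.X i₁)).obj (K₂'.obj.X i₂))).map (f₃.f i₃) ≫
      mapBifunctor₁₂.ι F₁₂ G K₁'.obj K₂'.obj K₃'.obj (ComplexShape.up ℤ) (ComplexShape.up ℤ)
        i₁ i₂ i₃ j h := by
  have h' : ComplexShape.π (ComplexShape.up ℤ) (ComplexShape.up ℤ) (ComplexShape.up ℤ)
    (ComplexShape.π (ComplexShape.up ℤ) (ComplexShape.up ℤ) (ComplexShape.up ℤ) (i₁, i₂), i₃) = j :=
    h
  rw [mapBifunctor₁₂.ι_eq _ _ _ _ _ _ _ _ _ _ _ _ rfl h',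
    mapBifunctor₁₂.ι_eq _ _ _ _ _ _ _ _ _ _ _ _ rfl h', Category.assoc, ι_mapBifunctorMap,
    ← NatTrans.comp_app_assoc, ← G.map_comp, ι_mapBifunctorMap, NatTrans.naturality_assoc]
  simp

theorem ι_mapBifunctorMap₂₃ {K₁ K₁' : CMinus C₁} {K₂ K₂' : CMinus C₂} {K₃ K₃' : CMinus C₃}
    (f₁ : K₁.obj ⟶ K₁'.obj) (f₂ : K₂.obj ⟶ K₂'.obj) (f₃ : K₃.obj ⟶ K₃'.obj)
    (i₁ i₂ i₃ j : ℤ)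
    (h : ComplexShape.r (ComplexShape.up ℤ) (ComplexShape.up ℤ) (ComplexShape.up ℤ)
      (ComplexShape.up ℤ) (ComplexShape.up ℤ) (i₁, i₂, i₃) = j) :
    mapBifunctor₂₃.ι F G₂₃ K₁.obj K₂.obj K₃.obj (ComplexShape.up ℤ) (ComplexShape.up ℤ)
        (ComplexShape.up ℤ) i₁ i₂ i₃ j h ≫
      (mapBifunctorMap f₁ (mapBifunctorMap f₂ f₃ G₂₃ (ComplexShape.up ℤ)) F
        (ComplexShape.up ℤ)).f j =
    (F.map (f₁.f i₁)).app ((G₂₃.obj (K₂.obj.X i₂)).obj (K₃.obj.X i₃)) ≫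
      (F.obj (K₁'.obj.X i₁)).map ((G₂₃.map (f₂.f i₂)).app (K₃.obj.X i₃) ≫
        (G₂₃.obj (K₂'.obj.X i₂)).map (f₃.f i₃)) ≫
      mapBifunctor₂₃.ι F G₂₃ K₁'.obj K₂'.obj K₃'.obj (ComplexShape.up ℤ) (ComplexShape.up ℤ)
        (ComplexShape.up ℤ) i₁ i₂ i₃ j h := by
  have h' : ComplexShape.π (ComplexShape.up ℤ) (ComplexShape.up ℤ) (ComplexShape.up ℤ)
      (i₁, ComplexShape.π (ComplexShape.up ℤ) (ComplexShape.up ℤ) (ComplexShape.up ℤ)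
        (i₂, i₃)) = j := by
    change i₁ + (i₂ + i₃) = j
    change i₁ + i₂ + i₃ = j at h
    lia
  rw [mapBifunctor₂₃.ι_eq _ _ _ _ _ _ _ _ _ _ _ _ _ rfl h',
    mapBifunctor₂₃.ι_eq _ _ _ _ _ _ _ _ _ _ _ _ _ rfl h', Category.assoc, ι_mapBifunctorMap,
    ← NatTrans.naturality_assoc, ← Functor.map_comp_assoc, ι_mapBifunctorMap]
  simp

theorem associatorCMinusApp_naturality (a : bifunctorComp₁₂ F₁₂ G ≅ bifunctorComp₂₃ F G₂₃)
    {K₁ K₁' : CMinus C₁} {K₂ K₂' : CMinus C₂} {K₃ K₃' : CMinus C₃}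
    (f₁ : K₁.obj ⟶ K₁'.obj) (f₂ : K₂.obj ⟶ K₂'.obj) (f₃ : K₃.obj ⟶ K₃'.obj) :
    mapBifunctorMap (mapBifunctorMap f₁ f₂ F₁₂ (ComplexShape.up ℤ)) f₃ G (ComplexShape.up ℤ) ≫
      (mapBifunctorAssociator a K₁'.obj K₂'.obj K₃'.obj (ComplexShape.up ℤ)
        (ComplexShape.up ℤ) (ComplexShape.up ℤ)).hom =
    (mapBifunctorAssociator a K₁.obj K₂.obj K₃.obj (ComplexShape.up ℤ)
        (ComplexShape.up ℤ) (ComplexShape.up ℤ)).hom ≫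
      mapBifunctorMap f₁ (mapBifunctorMap f₂ f₃ G₂₃ (ComplexShape.up ℤ)) F (ComplexShape.up ℤ) := by
  ext j : 1
  refine mapBifunctor₁₂.hom_ext fun i₁ i₂ i₃ h => ?_
  rw [comp_f, comp_f, ← Category.assoc, ι_mapBifunctorMap₁₂ f₁ f₂ f₃ i₁ i₂ i₃ j h]
  dsimp only [mapBifunctorAssociator, Hom.isoOfComponents]
  rw [Category.assoc, Category.assoc, ι_mapBifunctorAssociatorX_hom,
    ι_mapBifunctorAssociatorX_hom_assoc]
  erw [ι_mapBifunctorMap₂₃ (F := F) (G₂₃ := G₂₃) f₁ f₂ f₃ i₁ i₂ i₃ j h]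
  have e := congr($(trifunctorComponent_naturality a (f₁.f i₁) (f₂.f i₂) (f₃.f i₃)) ≫
    mapBifunctor₂₃.ι F G₂₃ K₁'.obj K₂'.obj K₃'.obj (ComplexShape.up ℤ) (ComplexShape.up ℤ)
      (ComplexShape.up ℤ) i₁ i₂ i₃ j h)
  simp only [Category.assoc] at e
  exact e

/-- The associativity isomorphism for bounded above complexes, as an isomorphism of trifunctors. -/
def associatorCMinus (a : bifunctorComp₁₂ F₁₂ G ≅ bifunctorComp₂₃ F G₂₃) :
    bifunctorComp₁₂ (mapBifunctorCMinus F₁₂) (mapBifunctorCMinus G) ≅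
      bifunctorComp₂₃ (mapBifunctorCMinus F) (mapBifunctorCMinus G₂₃) :=
  NatIso.ofComponents (fun K₁ => NatIso.ofComponents (fun K₂ => NatIso.ofComponents
    (fun K₃ => associatorCMinusApp a K₁ K₂ K₃)
    (fun {K₃ K₃'} f₃ => by
      refine ObjectProperty.hom_ext _ ?_
      have := associatorCMinusApp_naturality a (𝟙 K₁.obj) (𝟙 K₂.obj) f₃.hom
      rwa [show mapBifunctorMap (𝟙 K₁.obj) (𝟙 K₂.obj) F₁₂ _ = 𝟙 _ from
        congr($(((mapBifunctorCMinus F₁₂).obj K₁).map_id K₂).hom)] at this))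
    (fun {K₂ K₂'} f₂ => by
      ext K₃ : 2
      exact ObjectProperty.hom_ext _
        (associatorCMinusApp_naturality a (𝟙 K₁.obj) f₂.hom (𝟙 K₃.obj))))
    (fun {K₁ K₁'} f₁ => by
      ext K₂ K₃ : 4
      refine ObjectProperty.hom_ext _ ?_
      have := associatorCMinusApp_naturality a f₁.hom (𝟙 K₂.obj) (𝟙 K₃.obj)
      rwa [show mapBifunctorMap (𝟙 K₂.obj) (𝟙 K₃.obj) G₂₃ _ = 𝟙 _ from
        congr($(((mapBifunctorCMinus G₂₃).obj K₂).map_id K₃).hom)] at this)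

end Associator

section Single

open HomologicalComplex

/-- The complex with the object `X` in degree zero. -/
def singleCMinus {𝒜 : Type*} [Category* 𝒜] [Preadditive 𝒜] [HasZeroObject 𝒜] (X : 𝒜) :
    CMinus 𝒜 :=
  ⟨(CochainComplex.singleFunctor 𝒜 0).obj X, 0, inferInstance⟩

/-- The term of `X[0]` in degree zero is `X`. -/
def singleCMinusXZero {𝒜 : Type*} [Category* 𝒜] [Preadditive 𝒜] [HasZeroObject 𝒜] (X : 𝒜) :
    (singleCMinus X).obj.X 0 ≅ X :=
  singleObjXSelf (ComplexShape.up ℤ) 0 X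

variable {𝒜 ℬ 𝒞 : Type*} [Category* 𝒜] [Category* ℬ] [Category* 𝒞] [Preadditive 𝒜]
  [Preadditive ℬ] [Preadditive 𝒞] [HasZeroObject 𝒜] [HasFiniteCoproducts 𝒞]
  (F : 𝒜 ⥤ ℬ ⥤ 𝒞) [F.Additive] [∀ X, (F.obj X).Additive] (X : 𝒜)

instance isIso_totalProj_singleCMinus (K : CMinus ℬ) (n : ℤ) :
    IsIso (totalProj F (singleCMinus X) K n 0) := by
  refine ⟨totalIncl F (singleCMinus X) K n 0, total_hom_ext fun p => ?_, totalIncl_totalProj ..⟩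
  obtain rfl | hp := eq_or_ne p 0
  · rw [Category.assoc, totalIncl_totalProj, Category.comp_id, Category.id_comp]
  · exact (isZero_bifunctor_left F
      (isZero_single_obj_X (ComplexShape.up ℤ) 0 X p hp) _).eq_of_tgt _ _

/-- The identification of the term in degree `n` of the total complex of `F (X[0], K)`. -/
def singleTotalXIso (K : CMinus ℬ) (n : ℤ) :
    (mapBifunctor (singleCMinus X).obj K.obj F (ComplexShape.up ℤ)).X n ≅
      (F.obj X).obj (K.obj.X n) :=
  asIso (totalProj F (singleCMinus X) K n 0) ≪≫
    (F.mapIso (singleCMinusXZero X)).app (K.obj.X (n - 0)) ≪≫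
    (F.obj X).mapIso (K.obj.XIsoOfEq (sub_zero n))

theorem singleTotalXIso_hom (K : CMinus ℬ) (n : ℤ) : (singleTotalXIso F X K n).hom =
    totalProj F (singleCMinus X) K n 0 ≫ (F.map (singleCMinusXZero X).hom).app _ ≫
      (F.obj X).map (K.obj.XIsoOfEq (sub_zero n)).hom :=
  rfl

/-- The total complex of `F (X[0], K)` is `F (X, K)`. -/
def singleTotalIso (K : CMinus ℬ) :
    mapBifunctor (singleCMinus X).obj K.obj F (ComplexShape.up ℤ) ≅
      ((F.obj X).mapHomologicalComplex (ComplexShape.up ℤ)).obj K.obj :=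
  Hom.isoOfComponents (singleTotalXIso F X K) fun n n' h => by
    have hd : (singleCMinus X).obj.d (0 - 1) 0 = 0 := single_obj_d ..
    have hK : K.obj.d (n - 0) (n' - 0) ≫ (K.obj.XIsoOfEq (sub_zero n')).hom =
        (K.obj.XIsoOfEq (sub_zero n)).hom ≫ K.obj.d n n' := by
      rw [d_comp_XIsoOfEq_hom, XIsoOfEq_hom_comp_d]
    have hF := d_totalProj (F := F) (singleCMinus X) K n n' 0 h
    rw [hd, F.map_zero, Int.negOnePow_zero, one_smul, zero_app, zero_comp, comp_zero,
      zero_add] at hF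
    change (singleTotalXIso F X K n).hom ≫ (F.obj X).map (K.obj.d n n') =
      _ ≫ (singleTotalXIso F X K n').hom
    rw [singleTotalXIso_hom, singleTotalXIso_hom, reassoc_of% hF, NatTrans.naturality_assoc,
      ← Functor.map_comp, hK, Functor.map_comp, Category.assoc, Category.assoc]

theorem singleTotalIso_hom_naturality {K K' : CMinus ℬ} (f : K ⟶ K') :
    mapBifunctorMap (𝟙 (singleCMinus X).obj) f.hom F (ComplexShape.up ℤ) ≫
        (singleTotalIso F X K').hom =
      (singleTotalIso F X K).hom ≫
        ((F.obj X).mapHomologicalComplex (ComplexShape.up ℤ)).map f.hom := by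
  ext n : 1
  have hf : f.hom.f (n - 0) ≫ (K'.obj.XIsoOfEq (sub_zero n)).hom =
      (K.obj.XIsoOfEq (sub_zero n)).hom ≫ f.hom.f n := by
    simp [XIsoOfEq]
  have hF := map_totalProj (F := F) (singleCMinus X) f n 0
  change _ ≫ (singleTotalXIso F X K' n).hom =
    (singleTotalXIso F X K n).hom ≫ (F.obj X).map (f.hom.f n)
  rw [singleTotalXIso_hom, singleTotalXIso_hom, reassoc_of% hF, NatTrans.naturality_assoc,
    ← Functor.map_comp, hf, Functor.map_comp, Category.assoc, Category.assoc]

theorem quasiIso_mapBifunctorMap_singleCMinus_iff [CategoryWithHomology 𝒞] {K K' : CMinus ℬ}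
    (f : K ⟶ K') :
    QuasiIso (mapBifunctorMap (𝟙 (singleCMinus X).obj) f.hom F (ComplexShape.up ℤ)) ↔
      QuasiIso (((F.obj X).mapHomologicalComplex (ComplexShape.up ℤ)).map f.hom) := by
  rw [← quasiIso_iff_comp_right _ (singleTotalIso F X K').hom, singleTotalIso_hom_naturality,
    quasiIso_iff_comp_left]

variable {F X} in
/-- If `F (X, -)` is the identity then so is its extension to complexes. -/
def unitorCMinus {F : 𝒜 ⥤ 𝒞 ⥤ 𝒞} [F.Additive] [∀ X, (F.obj X).Additive] {X : 𝒜}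
    (e : F.obj X ≅ 𝟭 𝒞) : (mapBifunctorCMinus F).obj (singleCMinus X) ≅ 𝟭 (CMinus 𝒞) :=
  NatIso.ofComponents
    (fun K => (boundedAbove 𝒞).isoMk (singleTotalIso F X K ≪≫
      (NatIso.mapHomologicalComplex e (ComplexShape.up ℤ) ≪≫
        Functor.mapHomologicalComplexIdIso 𝒞 (ComplexShape.up ℤ)).app K.obj))
    fun {K K'} f => by
      refine ObjectProperty.hom_ext _ ?_
      have h := singleTotalIso_hom_naturality F X f
      have he := (NatIso.mapHomologicalComplex e (ComplexShape.up ℤ) ≪≫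
        Functor.mapHomologicalComplexIdIso 𝒞 (ComplexShape.up ℤ)).hom.naturality f.hom
      change mapBifunctorMap (𝟙 (singleCMinus X).obj) f.hom F (ComplexShape.up ℤ) ≫
        (singleTotalIso F X K').hom ≫ _ = ((singleTotalIso F X K).hom ≫ _) ≫ f.hom
      rw [reassoc_of% h, Category.assoc]
      exact congr((singleTotalIso F X K).hom ≫ $he)

end Single

section Deformation

open Functor

variable {C D H : Type*} [Category* C] [Category* D] [Category* H] (L : C ⥤ D)
  (W : MorphismProperty C) [L.IsLocalization W] (F : C ⥤ H) {Q : C ⥤ C} (ε : Q ⟶ 𝟭 C)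
  (hQ : W.IsInvertedBy (Q ⋙ F))

/-- The counit `L ⋙ LF ⟶ F` of the functor `LF` induced by `Q ⋙ F`. -/
def deformationCounit : L ⋙ Localization.lift (Q ⋙ F) hQ L ⟶ F :=
  (Localization.fac (Q ⋙ F) hQ L).hom ≫ whiskerRight ε F ≫ F.leftUnitor.hom

theorem deformationCounit_app (X : C) : (deformationCounit L W F ε hQ).app X =
    (Localization.fac (Q ⋙ F) hQ L).hom.app X ≫ F.map (ε.app X) := by
  simp [deformationCounit]

variable {L W F ε hQ}

theorem exists_whiskerLeft_comp_deformationCounit (hε : ∀ X, W (ε.app X)) {G : D ⥤ H}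
    (a : L ⋙ G ⟶ F) : ∃ b : G ⟶ Localization.lift (Q ⋙ F) hQ L,
      whiskerLeft L b ≫ deformationCounit L W F ε hQ = a := by
  have (X : C) : IsIso (L.map (ε.app X)) := Localization.inverts L W _ (hε X)
  have (X : C) : IsIso ((whiskerRight ε (L ⋙ G)).app X) :=
    inferInstanceAs (IsIso (G.map (L.map (ε.app X))))
  let e := Localization.fac (Q ⋙ F) hQ L
  have := NatIso.isIso_of_isIso_app (whiskerRight ε (L ⋙ G))
  let a' : L ⋙ G ⟶ Q ⋙ F :=
    (L ⋙ G).leftUnitor.inv ≫ inv (whiskerRight ε (L ⋙ G)) ≫ whiskerLeft Q a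
  have ha' : a' ≫ whiskerRight ε F ≫ F.leftUnitor.hom = a := by
    have h : whiskerLeft Q a ≫ whiskerRight ε F = whiskerRight ε (L ⋙ G) ≫ whiskerLeft (𝟭 C) a := by
      ext X
      exact (a.naturality (ε.app X)).symm
    simp only [a', Category.assoc]
    rw [reassoc_of% h, IsIso.inv_hom_id_assoc]
    ext X
    simp
  refine ⟨Localization.liftNatTrans L W (L ⋙ G) (Q ⋙ F) G _ a', ?_⟩
  rw [← ha']
  ext X
  rw [NatTrans.comp_app, deformationCounit_app, whiskerLeft_app, Localization.liftNatTrans_app]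
  change (𝟙 _ ≫ a'.app X ≫ e.inv.app X) ≫ e.hom.app X ≫ F.map (ε.app X) = _
  simp

theorem whiskerLeft_comp_deformationCounit_injective (hε : ∀ X, W (ε.app X))
    (hF : ∀ X, IsIso (F.map (ε.app (Q.obj X)))) {G : D ⥤ H}
    {b b' : G ⟶ Localization.lift (Q ⋙ F) hQ L}
    (h : whiskerLeft L b ≫ deformationCounit L W F ε hQ =
      whiskerLeft L b' ≫ deformationCounit L W F ε hQ) : b = b' := by
  refine Localization.natTrans_ext L W fun X => ?_
  have := hF X
  have hX : IsIso (L.map (ε.app X)) := Localization.inverts L W _ (hε X)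
  have hQX : b.app (L.obj (Q.obj X)) = b'.app (L.obj (Q.obj X)) := by
    have := NatTrans.congr_app h (Q.obj X)
    dsimp at this
    rwa [deformationCounit_app, ← Category.assoc, ← Category.assoc, cancel_mono,
      cancel_mono] at this
  have hb := b.naturality (L.map (ε.app X))
  have hb' := b'.naturality (L.map (ε.app X))
  rwa [hQX, ← hb', cancel_epi] at hb

theorem isLeftDerivedFunctor_of_deformation (hε : ∀ X, W (ε.app X))
    (hF : ∀ X, IsIso (F.map (ε.app (Q.obj X)))) :
    (Localization.lift (Q ⋙ F) hQ L).IsLeftDerivedFunctor (deformationCounit L W F ε hQ) W := by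
  choose lift hlift using fun E : RightExtension L F =>
    exists_whiskerLeft_comp_deformationCounit (hQ := hQ) hε E.hom
  exact ⟨⟨⟨IsTerminal.ofUniqueHom (fun E => CostructuredArrow.homMk (lift E) (hlift E))
    fun E m => CostructuredArrow.hom_ext _ _ (whiskerLeft_comp_deformationCounit_injective hε hF
      ((CostructuredArrow.w m).trans (hlift E).symm))⟩⟩⟩

end Deformation

section ExactTerms

open HomologicalComplex

variable {𝒜 ℬ 𝒞 : Type*} [Category* 𝒜] [Category* ℬ] [Category* 𝒞]
  [Abelian 𝒜] [Abelian ℬ] [Abelian 𝒞]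

theorem preservesHomology_of_sum_retract {H : 𝒜 ⥤ ℬ} [H.Additive] {J : Type*} (s : Finset J)
    {G : J → 𝒜 ⥤ ℬ} [∀ j, (G j).PreservesZeroMorphisms] [∀ j, (G j).PreservesHomology]
    (α : ∀ j, H ⟶ G j) (β : ∀ j, G j ⟶ H) (h : ∑ j ∈ s, α j ≫ β j = 𝟙 H) : H.PreservesHomology := by
  refine ((Functor.exact_tfae H).out 1 2).1 fun S hS => ?_
  have hG (j : J) : (S.map (G j)).iCycles ≫ (S.map (G j)).pOpcycles = 0 :=
    (S.map (G j)).exact_iff_iCycles_pOpcycles_zero.1 (hS.map (G j))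
  have hid : ∑ j ∈ s, (α j).app S.X₂ ≫ (β j).app S.X₂ = 𝟙 (H.obj S.X₂) := by
    simp only [← NatTrans.comp_app, ← NatTrans.app_sum, h, NatTrans.id_app]
  let ι : (S.map H).cycles ⟶ H.obj S.X₂ := (S.map H).iCycles
  let π : H.obj S.X₂ ⟶ (S.map H).opcycles := (S.map H).pOpcycles
  have hαβ (j : J) : ι ≫ ((α j).app S.X₂ ≫ (β j).app S.X₂) ≫ π = 0 := by
    change (S.map H).iCycles ≫ ((S.mapNatTrans (α j)).τ₂ ≫ (S.mapNatTrans (β j)).τ₂) ≫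
      (S.map H).pOpcycles = 0
    rw [Category.assoc, ← ShortComplex.p_opcyclesMap, ← ShortComplex.cyclesMap_i_assoc,
      reassoc_of% hG, zero_comp, comp_zero]
  refine (S.map H).exact_iff_iCycles_pOpcycles_zero.2 ?_
  change ι ≫ π = 0
  rw [← Category.id_comp π, ← hid, Preadditive.sum_comp, Preadditive.comp_sum]
  exact Finset.sum_eq_zero fun j _ => hαβ j

theorem preservesHomology_of_isZero {H : 𝒜 ⥤ ℬ} [H.Additive] (hH : IsZero H) :
    H.PreservesHomology :=
  ((Functor.exact_tfae H).out 1 2).1 fun (S : ShortComplex 𝒜) _ =>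
    ShortComplex.exact_of_isZero_X₂ _ ((Functor.isZero_iff H).1 hH S.X₂)

theorem preservesHomology_of_iso {H G : 𝒜 ⥤ ℬ} [H.Additive] [G.PreservesZeroMorphisms]
    [G.PreservesHomology] (e : H ≅ G) : H.PreservesHomology :=
  preservesHomology_of_sum_retract {()} (G := fun _ => G) (fun _ => e.hom) (fun _ => e.inv)
    (by simp)

theorem preservesHomology_of_comp_faithful (H : 𝒜 ⥤ ℬ) [H.Additive] (U : ℬ ⥤ 𝒞) [U.Additive]
    [U.Faithful] [U.PreservesHomology] [(H ⋙ U).PreservesHomology] : H.PreservesHomology := by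
  refine ((Functor.exact_tfae H).out 1 2).1 fun S hS => ?_
  exact ((S.map H).exact_map_iff_of_faithful U).1 (hS.map (H ⋙ U))

variable {F : 𝒜 ⥤ ℬ ⥤ 𝒞} [F.Additive] [∀ X, (F.obj X).Additive]

instance preservesHomology_obj_singleCMinus_X (X : 𝒜) [(F.obj X).PreservesHomology] (p : ℤ) :
    (F.obj ((singleCMinus X).obj.X p)).PreservesHomology := by
  obtain rfl | hp := eq_or_ne p 0
  · exact preservesHomology_of_iso (F.mapIso (singleCMinusXZero X))
  · exact preservesHomology_of_isZero
      (F.map_isZero (isZero_single_obj_X (ComplexShape.up ℤ) 0 X p hp))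

instance preservesHomology_obj_total_X (K : CMinus 𝒜) (L : CMinus ℬ)
    {𝒟 ℰ : Type*} [Category* 𝒟] [Category* ℰ] [Abelian 𝒟] [Abelian ℰ]
    (G : 𝒞 ⥤ 𝒟 ⥤ ℰ) [G.Additive] [∀ X, (G.obj X).Additive]
    [∀ p q, (G.obj ((F.obj (K.obj.X p)).obj (L.obj.X q))).PreservesHomology] (n : ℤ) :
    (G.obj ((((mapBifunctorCMinus F).obj K).obj L).obj.X n)).PreservesHomology := by
  obtain ⟨s, hs⟩ := exists_sum_totalProj_totalIncl (F := F) K L n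
  refine preservesHomology_of_sum_retract s (fun p => G.map (totalProj F K L n p))
    (fun p => G.map (totalIncl F K L n p)) ?_
  have hGs := congrArg G.map hs
  simp only [G.map_sum, G.map_comp, G.map_id] at hGs
  exact hGs

theorem quasiIso_mapBifunctorMap_of_exact_of_projective [EnoughProjectives ℬ]
    (hF : ∀ (Y : ℬ) [Projective Y], (F.flip.obj Y).PreservesHomology) {K K' : CMinus 𝒜}
    [∀ p, (F.obj (K.obj.X p)).PreservesHomology] [∀ p, (F.obj (K'.obj.X p)).PreservesHomology]
    (f : K ⟶ K') [QuasiIso f.hom] (L : CMinus ℬ) :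
    QuasiIso (mapBifunctorMap f.hom (𝟙 L.obj) F (ComplexShape.up ℤ)) := by
  refine quasiIso_mapBifunctorMap_of_rows f L fun q => ?_
  let R : CMinus ℬ := ⟨(projectiveResolution (L.obj.X q)).cochainComplex, 0, inferInstance⟩
  let π : R ⟶ singleCMinus (L.obj.X q) :=
    ObjectProperty.homMk (projectiveResolution (L.obj.X q)).π'
  have : QuasiIso π.hom := inferInstanceAs (QuasiIso (projectiveResolution (L.obj.X q)).π')
  have (n : ℤ) : Projective (R.obj.X n) :=
    inferInstanceAs (Projective ((projectiveResolution (L.obj.X q)).cochainComplex.X n))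
  have (n : ℤ) := hF (R.obj.X n)
  rw [← quasiIso_mapBifunctorMap_singleCMinus_iff]
  exact (quasiIso_mapBifunctorMap_flip_iff F f (𝟙 _)).2
    (quasiIso_mapBifunctorMap_of_quasiIso_right f π)

end ExactTerms

section FGModules

variable {R : Type u} [Ring R] [IsNoetherianRing R]

instance : (forget₂ (FGModuleCat.{u} R) (ModuleCat.{u} R)).Additive where

theorem fgModuleCat_epi_iff_surjective {X Y : FGModuleCat.{u} R} (f : X ⟶ Y) :
    Epi f ↔ Function.Surjective f.hom.hom :=
  ((forget₂ (FGModuleCat.{u} R) (ModuleCat.{u} R)).epi_map_iff_epi f).symm.trans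
    (ModuleCat.epi_iff_surjective _)

variable (R) in
/-- The free module of rank `n`. -/
abbrev fgFree (n : ℕ) : FGModuleCat.{u} R := FGModuleCat.of R (Fin n → R)

instance (n : ℕ) : Projective (fgFree R n) where
  factors f e _ := by
    obtain ⟨g, hg⟩ := Module.projective_lifting_property e.hom.hom f.hom.hom
      ((fgModuleCat_epi_iff_surjective e).1 inferInstance)
    exact ⟨FGModuleCat.ofHom g, FGModuleCat.hom_ext hg⟩

theorem exists_fgFree_epi (X : FGModuleCat.{u} R) : ∃ (n : ℕ) (p : fgFree R n ⟶ X), Epi p := by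
  obtain ⟨n, p, hp⟩ := Module.Finite.exists_fin' R X
  exact ⟨n, FGModuleCat.ofHom p, (fgModuleCat_epi_iff_surjective _).2 hp⟩

instance : EnoughProjectives (FGModuleCat.{u} R) where
  presentation X := by
    obtain ⟨n, p, hp⟩ := exists_fgFree_epi X
    exact ⟨{ p := fgFree R n, f := p, epi := hp }⟩

theorem exists_dualBasis (X : FGModuleCat.{u} R) [Projective X] :
    ∃ (n : ℕ) (x : Fin n → X) (φ : Fin n → X →ₗ[R] R), ∀ y, ∑ i, φ i y • x i = y := by
  obtain ⟨n, p, hp⟩ := exists_fgFree_epi X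
  let s : X ⟶ fgFree R n := Projective.factorThru (𝟙 X) p
  have hs : s ≫ p = 𝟙 X := Projective.factorThru_comp ..
  refine ⟨n, fun i => p.hom.hom (Pi.single i 1 : Fin n → R),
    fun i => LinearMap.proj i ∘ₗ s.hom.hom, fun y => ?_⟩
  calc ∑ i, s.hom.hom y i • p.hom.hom (Pi.single i 1 : Fin n → R)
      = p.hom.hom (∑ i, s.hom.hom y i • (Pi.single i 1 : Fin n → R)) := by
        simp only [map_sum, map_smul]
    _ = p.hom.hom (s.hom.hom y) := congrArg p.hom.hom (pi_eq_sum_univ' _).symm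
    _ = y := congr(($hs).hom.hom y)

end FGModules

section BimoduleTensor

variable {k A B C : Type u} [Field k] [Ring A] [Algebra k A] [Ring B] [Algebra k B]
  [Ring C] [Algebra k C]

theorem zero_smul_bimod (X : FGBimod k A B) (x : X) : (0 : A ⊗[k] Bᵐᵒᵖ) • x = 0 :=
  Module.zero_smul x

/-- A `k`-linear map commuting with both actions, as a morphism of bimodules. -/
def bimodHom {X Y : FGBimod k A B} (f : X →ₗ[k] Y)
    (hl : ∀ (a : A) (x : X), f ((a ⊗ₜ[k] (1 : Bᵐᵒᵖ)) • x) = (a ⊗ₜ[k] (1 : Bᵐᵒᵖ)) • f x)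
    (hr : ∀ (b : Bᵐᵒᵖ) (x : X), f (((1 : A) ⊗ₜ[k] b) • x) = ((1 : A) ⊗ₜ[k] b) • f x) : X ⟶ Y :=
  FGModuleCat.ofHom
    { toFun := f
      map_add' := map_add f
      map_smul' := fun r x => by
        induction r using TensorProduct.induction_on with
        | zero =>
          exact (congrArg f (zero_smul_bimod X x)).trans
            ((map_zero f).trans (zero_smul_bimod Y (f x)).symm)
        | add r s hr hs => simp only [add_smul, map_add, hr, hs, RingHom.id_apply]
        | tmul a b =>
          have h : a ⊗ₜ[k] b = (a ⊗ₜ[k] (1 : Bᵐᵒᵖ)) * ((1 : A) ⊗ₜ[k] b) := by simp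
          rw [h, mul_smul, hl, hr, RingHom.id_apply, mul_smul] }

theorem balancedRelations_le_ker_lift {L : FGBimod k A B} {M : FGBimod k B C} {Z : Type u}
    [AddCommGroup Z] [Module k Z] (φ : L →ₗ[k] M →ₗ[k] Z)
    (hφ : ∀ (l : L) (b : B) (m : M),
      φ (((1 : A) ⊗ₜ[k] MulOpposite.op b) • l) m = φ l ((b ⊗ₜ[k] (1 : Cᵐᵒᵖ)) • m)) :
    balancedRelations k A B C L M ≤ LinearMap.ker (TensorProduct.lift φ) := by
  refine Submodule.span_le.2 ?_
  rintro _ ⟨l, b, m, rfl⟩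
  simp [hφ]

variable [FiniteDimensional k A] [FiniteDimensional k B] [FiniteDimensional k C]

/-- The tensor product of two bimodules. -/
abbrev tensorObj (L : FGBimod k A B) (M : FGBimod k B C) : FGBimod k A C :=
  ((tensorBimod k A B C).obj L).obj M

/-- The pure tensor `l ⊗ m` in `L ⊗_B M`. -/
def tmul (L : FGBimod k A B) (M : FGBimod k B C) (l : L) (m : M) : tensorObj L M :=
  BalancedTensor.mk k A B C L M (l ⊗ₜ m)

variable (L : FGBimod k A B) (M : FGBimod k B C)

theorem add_tmul (l l' : L) (m : M) : tmul L M (l + l') m = tmul L M l m + tmul L M l' m := by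
  change BalancedTensor.mk k A B C L M _ =
    BalancedTensor.mk k A B C L M _ + BalancedTensor.mk k A B C L M _
  rw [← map_add, TensorProduct.add_tmul]

theorem tmul_add (l : L) (m m' : M) : tmul L M l (m + m') = tmul L M l m + tmul L M l m' := by
  change BalancedTensor.mk k A B C L M _ =
    BalancedTensor.mk k A B C L M _ + BalancedTensor.mk k A B C L M _
  rw [← map_add, TensorProduct.tmul_add]

theorem tmul_balanced (l : L) (b : B) (m : M) :
    tmul L M (((1 : A) ⊗ₜ[k] MulOpposite.op b) • l) m =
      tmul L M l ((b ⊗ₜ[k] (1 : Cᵐᵒᵖ)) • m) :=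
  (Submodule.Quotient.eq _).2 (Submodule.subset_span ⟨l, b, m, rfl⟩)

theorem tmul_smul_smul (a : A) (c : Cᵐᵒᵖ) (l : L) (m : M) :
    tmul L M ((a ⊗ₜ[k] (1 : Bᵐᵒᵖ)) • l) (((1 : B) ⊗ₜ[k] c) • m) =
      (a ⊗ₜ[k] c) • tmul L M l m :=
  congrArg (BalancedTensor.mk k A B C L M) (outerAction_tmul k A B C L M a c l m).symm

theorem smul_left_tmul (a : A) (l : L) (m : M) :
    (a ⊗ₜ[k] (1 : Cᵐᵒᵖ)) • tmul L M l m = tmul L M ((a ⊗ₜ[k] (1 : Bᵐᵒᵖ)) • l) m := by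
  rw [← tmul_smul_smul, ← Algebra.TensorProduct.one_def, one_smul]

theorem smul_right_tmul (c : Cᵐᵒᵖ) (l : L) (m : M) :
    ((1 : A) ⊗ₜ[k] c) • tmul L M l m = tmul L M l (((1 : B) ⊗ₜ[k] c) • m) := by
  rw [← tmul_smul_smul, ← Algebra.TensorProduct.one_def, one_smul]

theorem smul_tmul (c : k) (l : L) (m : M) : c • tmul L M l m = tmul L M (c • l) m := by
  have h := smul_left_tmul L M (algebraMap k A c) l m
  rwa [← Algebra.TensorProduct.algebraMap_apply, ← Algebra.TensorProduct.algebraMap_apply] at h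

theorem tmul_smul (c : k) (l : L) (m : M) : tmul L M l (c • m) = c • tmul L M l m := by
  have h := smul_right_tmul L M (algebraMap k _ c) l m
  rw [← Algebra.TensorProduct.algebraMap_apply', ← Algebra.TensorProduct.algebraMap_apply'] at h
  exact h.symm

/-- Pure tensors as a bilinear map. -/
def tmulₗ : L →ₗ[k] M →ₗ[k] tensorObj L M :=
  LinearMap.mk₂ k (tmul L M) (add_tmul L M) (fun c l m => (smul_tmul L M c l m).symm)
    (tmul_add L M) (fun c l m => tmul_smul L M c l m)

theorem tmulₗ_apply (l : L) (m : M) : tmulₗ L M l m = tmul L M l m := rfl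

variable {L M}

@[elab_as_elim]
theorem tensor_induction {p : tensorObj L M → Prop} (zero : p 0) (tmul : ∀ l m, p (tmul L M l m))
    (add : ∀ x y, p x → p y → p (x + y)) (x : tensorObj L M) : p x := by
  obtain ⟨x, rfl⟩ := BalancedTensor.mk_surjective k A B C L M x
  induction x using TensorProduct.induction_on with
  | zero => exact zero
  | tmul l m => exact tmul l m
  | add x y hx hy => exact (map_add (BalancedTensor.mk k A B C L M) x y) ▸ add _ _ hx hy

theorem tensorObj_hom_ext {Z : FGBimod k A C} {f g : tensorObj L M ⟶ Z}
    (h : ∀ l m, f.hom.hom (tmul L M l m) = g.hom.hom (tmul L M l m)) : f = g :=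
  FGModuleCat.hom_ext (BalancedTensor.hom_ext k A B C h)

section Lift

variable {Z : Type u} [AddCommGroup Z] [Module k Z] (φ : L →ₗ[k] M →ₗ[k] Z)
  (hφ : ∀ (l : L) (b : B) (m : M),
    φ (((1 : A) ⊗ₜ[k] MulOpposite.op b) • l) m = φ l ((b ⊗ₜ[k] (1 : Cᵐᵒᵖ)) • m))

/-- The `k`-linear map on `L ⊗_B M` given by a balanced bilinear map. The vector space structure
of `L ⊗_B M` is restricted from the bimodule structure, hence scalars have to be moved. -/
def tensorLift : tensorObj L M →ₗ[k] Z :=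
  let ψ : BalancedTensor k A B C L M →ₗ[k] Z :=
    (balancedRelations k A B C L M).liftQ (TensorProduct.lift φ)
      (balancedRelations_le_ker_lift φ hφ)
  { toFun := ψ
    map_add' := map_add ψ
    map_smul' c x := by
      have hψ (y : BalancedTensor k A B C L M) :
          ψ (algebraMap k (A ⊗[k] Cᵐᵒᵖ) c • y) = c • ψ y := by
        rw [algebraMap_smul, map_smul]
      exact hψ x }

@[simp]
theorem tensorLift_tmul (l : L) (m : M) : tensorLift φ hφ (tmul L M l m) = φ l m := rfl

end Lift

/-- The morphism of bimodules on `L ⊗_B M` given by a balanced bilinear map compatible with the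
outer actions. -/
def tensorDesc {Z : FGBimod k A C} (φ : L →ₗ[k] M →ₗ[k] Z)
    (hφ : ∀ (l : L) (b : B) (m : M),
      φ (((1 : A) ⊗ₜ[k] MulOpposite.op b) • l) m = φ l ((b ⊗ₜ[k] (1 : Cᵐᵒᵖ)) • m))
    (hl : ∀ (a : A) (l : L) (m : M),
      φ ((a ⊗ₜ[k] (1 : Bᵐᵒᵖ)) • l) m = (a ⊗ₜ[k] (1 : Cᵐᵒᵖ)) • φ l m)
    (hr : ∀ (c : Cᵐᵒᵖ) (l : L) (m : M),
      φ l (((1 : B) ⊗ₜ[k] c) • m) = ((1 : A) ⊗ₜ[k] c) • φ l m) : tensorObj L M ⟶ Z :=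
  bimodHom (tensorLift φ hφ)
    (fun a x => by
      induction x using tensor_induction with
      | zero => simp only [smul_zero, map_zero]
      | tmul l m => simp only [smul_left_tmul, tensorLift_tmul, hl]
      | add x y hx hy => simp only [smul_add, map_add, hx, hy])
    (fun c x => by
      induction x using tensor_induction with
      | zero => simp only [smul_zero, map_zero]
      | tmul l m => simp only [smul_right_tmul, tensorLift_tmul, hr]
      | add x y hx hy => simp only [smul_add, map_add, hx, hy])

end BimoduleTensor

section Unitors

variable (k A B C : Type u) [Field k] [Ring A] [Algebra k A] [Ring B] [Algebra k B]
  [Ring C] [Algebra k C]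
  [FiniteDimensional k A] [FiniteDimensional k B] [FiniteDimensional k C]

/-- The algebra `B` as a bimodule over itself. -/
def regularBimod : FGBimod k B B :=
  letI : Module (B ⊗[k] Bᵐᵒᵖ) B := TensorProduct.Algebra.module
  haveI : IsScalarTower k (B ⊗[k] Bᵐᵒᵖ) B := ⟨fun c r x => by
    induction r using TensorProduct.induction_on with
    | zero =>
      have h : (0 : B ⊗[k] Bᵐᵒᵖ) • x = 0 := Module.zero_smul x
      rw [smul_zero, h, smul_zero]
    | add r s hr hs => rw [smul_add, add_smul, add_smul, smul_add, hr, hs]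
    | tmul b c' =>
      rw [TensorProduct.smul_tmul', TensorProduct.Algebra.smul_def,
        TensorProduct.Algebra.smul_def, smul_assoc]⟩
  haveI : Module.Finite (B ⊗[k] Bᵐᵒᵖ) B := Module.Finite.of_restrictScalars_finite k _ _
  FGModuleCat.of (B ⊗[k] Bᵐᵒᵖ) B

variable {k B}

theorem smul_regularBimod (a : B) (c : Bᵐᵒᵖ) (b : B) :
    (a ⊗ₜ[k] c) • (show regularBimod k B from b) = show regularBimod k B from a * (b * c.unop) :=
  rfl

/-- The regular bimodule is the algebra, as a vector space. -/
def regularEquiv : B ≃ₗ[k] regularBimod k B where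
  toFun b := b
  invFun b := b
  map_add' _ _ := rfl
  map_smul' c b := by
    refine Eq.trans ?_ (smul_regularBimod (algebraMap k B c) 1 b).symm
    exact ((Algebra.smul_def c b).trans
      (congrArg (algebraMap k B c * ·) (mul_one b).symm))

theorem smul_regularEquiv (a : B) (c : Bᵐᵒᵖ) (b : B) :
    (a ⊗ₜ[k] c) • regularEquiv (k := k) b = regularEquiv (a * (b * c.unop)) := rfl

theorem regularEquiv_symm_smul (a : B) (c : Bᵐᵒᵖ) (b : regularBimod k B) :
    regularEquiv.symm ((a ⊗ₜ[k] c) • b) = a * (regularEquiv.symm b * c.unop) := rfl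

variable {A C} (L : FGBimod k A B) (M : FGBimod k B C)

/-- The isomorphism `B ⊗_B M ≅ M`. -/
def tensorLeftUnitor : tensorObj (regularBimod k B) M ≅ M where
  hom := tensorDesc
    ((Algebra.lsmul k k M).toLinearMap ∘ₗ
      (Algebra.TensorProduct.includeLeft : B →ₐ[k] B ⊗[k] Cᵐᵒᵖ).toLinearMap ∘ₗ
      regularEquiv.symm.toLinearMap)
    (fun b c m => by simp [regularEquiv_symm_smul, smul_smul])
    (fun b c m => by simp [regularEquiv_symm_smul, smul_smul])
    (fun c b m => by simp [smul_smul])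
  inv := bimodHom (tmulₗ (regularBimod k B) M (regularEquiv 1))
    (fun b x => by
      simp only [tmulₗ_apply, ← tmul_balanced, smul_left_tmul, smul_regularEquiv]
      simp)
    (fun b x => by simp only [tmulₗ_apply, smul_right_tmul])
  hom_inv_id := by
    refine tensorObj_hom_ext fun b m => ?_
    change tmul (regularBimod k B) M (regularEquiv 1)
      ((regularEquiv.symm b ⊗ₜ[k] (1 : Cᵐᵒᵖ)) • m) = tmul (regularBimod k B) M b m
    rw [← tmul_balanced, smul_regularEquiv]
    simp
  inv_hom_id := by
    refine FGModuleCat.hom_ext (LinearMap.ext fun m => ?_)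
    change (regularEquiv.symm (regularEquiv (1 : B)) ⊗ₜ[k] (1 : Cᵐᵒᵖ)) • m = m
    rw [LinearEquiv.symm_apply_apply, ← Algebra.TensorProduct.one_def, one_smul]

/-- The isomorphism `L ⊗_B B ≅ L`. -/
def tensorRightUnitor : tensorObj L (regularBimod k B) ≅ L where
  hom := tensorDesc
    ((Algebra.lsmul k k L).toLinearMap ∘ₗ
      (Algebra.TensorProduct.includeRight : Bᵐᵒᵖ →ₐ[k] A ⊗[k] Bᵐᵒᵖ).toLinearMap ∘ₗ
      (MulOpposite.opLinearEquiv k).toLinearMap ∘ₗ regularEquiv.symm.toLinearMap).flip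
    (fun l b c => by simp [regularEquiv_symm_smul, smul_smul])
    (fun a l c => by simp [smul_smul])
    (fun b l c => by simp [regularEquiv_symm_smul, smul_smul])
  inv := bimodHom ((tmulₗ L (regularBimod k B)).flip (regularEquiv 1))
    (fun b x => by simp only [LinearMap.flip_apply, tmulₗ_apply, smul_left_tmul])
    (fun b x => by
      have h := tmul_balanced L (regularBimod k B) x b.unop (regularEquiv 1)
      rw [MulOpposite.op_unop] at h
      simp only [LinearMap.flip_apply, tmulₗ_apply, h, smul_right_tmul, smul_regularEquiv]
      simp)
  hom_inv_id := by
    refine tensorObj_hom_ext fun l b => ?_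
    change tmul L (regularBimod k B) (((1 : A) ⊗ₜ[k] MulOpposite.op (regularEquiv.symm b)) • l)
      (regularEquiv 1) = tmul L (regularBimod k B) l b
    rw [tmul_balanced, smul_regularEquiv]
    simp
  inv_hom_id := by
    refine FGModuleCat.hom_ext (LinearMap.ext fun m => ?_)
    change ((1 : A) ⊗ₜ[k] MulOpposite.op (regularEquiv.symm (regularEquiv (1 : B)))) • m = m
    rw [LinearEquiv.symm_apply_apply, MulOpposite.op_one, ← Algebra.TensorProduct.one_def, one_smul]

variable (k A B C)

/-- The natural isomorphism `B ⊗_B M ≅ M`. -/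
def tensorLeftUnitorIso : (tensorBimod k B B C).obj (regularBimod k B) ≅ 𝟭 _ :=
  NatIso.ofComponents (fun M => tensorLeftUnitor M) fun f =>
    tensorObj_hom_ext fun _ _ => (map_smul f.hom.hom _ _).symm

/-- The natural isomorphism `L ⊗_B B ≅ L`. -/
def tensorRightUnitorIso : (tensorBimod k A B B).flip.obj (regularBimod k B) ≅ 𝟭 _ :=
  NatIso.ofComponents (fun L => tensorRightUnitor L) fun f =>
    tensorObj_hom_ext fun _ _ => (map_smul f.hom.hom _ _).symm

end Unitors

section Associator

variable {k A B C D : Type u} [Field k] [Ring A] [Algebra k A] [Ring B] [Algebra k B]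
  [Ring C] [Algebra k C] [Ring D] [Algebra k D]
  [FiniteDimensional k A] [FiniteDimensional k B] [FiniteDimensional k C] [FiniteDimensional k D]
  {L : FGBimod k A B} {M : FGBimod k B C} {N : FGBimod k C D} {Z : FGBimod k A D}

theorem tensorObj_tensorObj_linearMap_ext {W : Type u} [AddCommGroup W] [Module k W]
    {f g : tensorObj (tensorObj L M) N →ₗ[k] W}
    (h : ∀ l m n, f (tmul _ N (tmul L M l m) n) = g (tmul _ N (tmul L M l m) n)) : f = g := by
  refine LinearMap.ext fun z => ?_
  induction z using tensor_induction with
  | zero => simp only [map_zero]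
  | add z w hz hw => simp only [map_add, hz, hw]
  | tmul x n =>
    induction x using tensor_induction with
    | zero => simp only [← tmulₗ_apply, map_zero, LinearMap.zero_apply]
    | tmul l m => exact h l m n
    | add x y hx hy => simp only [add_tmul, map_add, hx, hy]

theorem tensorObj_tensorObj_hom_ext {f g : tensorObj (tensorObj L M) N ⟶ Z}
    (h : ∀ l m n, f.hom.hom (tmul _ N (tmul L M l m) n) = g.hom.hom (tmul _ N (tmul L M l m) n)) :
    f = g :=
  FGModuleCat.hom_ext (LinearMap.restrictScalars_injective k (tensorObj_tensorObj_linearMap_ext h))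

theorem tensorObj_tensorObj_hom_ext' {f g : tensorObj L (tensorObj M N) ⟶ Z}
    (h : ∀ l m n, f.hom.hom (tmul L _ l (tmul M N m n)) = g.hom.hom (tmul L _ l (tmul M N m n))) :
    f = g := by
  refine tensorObj_hom_ext fun l x => ?_
  induction x using tensor_induction with
  | zero => simp only [← tmulₗ_apply, map_zero]
  | tmul m n => exact h l m n
  | add x y hx hy => simp only [tmul_add, map_add, hx, hy]

variable (L M N)

/-- The morphism `(l ⊗ m) ⊗ n ↦ l ⊗ (m ⊗ n)`. -/
def tensorAssocHom : tensorObj (tensorObj L M) N ⟶ tensorObj L (tensorObj M N) :=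
  tensorDesc
    (tensorLift (LinearMap.mk₂ k (fun l m => tmulₗ L (tensorObj M N) l ∘ₗ tmulₗ M N m)
        (fun l l' m => by ext; simp) (fun c l m => by ext; simp)
        (fun l m m' => by ext; simp) (fun c l m => by ext; simp))
      fun l b m => by
        ext n
        simp [tmulₗ_apply, tmul_balanced, smul_left_tmul])
    (fun x c n => by
      induction x using tensor_induction with
      | zero => simp
      | tmul l m => simp [smul_right_tmul, tmulₗ_apply, tmul_balanced]
      | add x y hx hy => simp only [smul_add, map_add, LinearMap.add_apply, hx, hy])
    (fun a x n => by
      induction x using tensor_induction with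
      | zero => simp
      | tmul l m => simp [smul_left_tmul, tmulₗ_apply]
      | add x y hx hy => simp only [smul_add, map_add, LinearMap.add_apply, hx, hy])
    (fun d x n => by
      induction x using tensor_induction with
      | zero => simp
      | tmul l m => simp [smul_right_tmul, tmulₗ_apply]
      | add x y hx hy => simp only [smul_add, map_add, LinearMap.add_apply, hx, hy])

/-- The morphism `l ⊗ (m ⊗ n) ↦ (l ⊗ m) ⊗ n`. -/
def tensorAssocInv : tensorObj L (tensorObj M N) ⟶ tensorObj (tensorObj L M) N :=
  tensorDesc
    (tensorLift (LinearMap.mk₂ k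
        (fun m n => (tmulₗ (tensorObj L M) N).flip n ∘ₗ (tmulₗ L M).flip m)
        (fun m m' n => by ext; simp) (fun c m n => by ext; simp)
        (fun m n n' => by ext; simp) (fun c m n => by ext; simp))
      fun m c n => by
        ext l
        simp [tmulₗ_apply, ← tmul_balanced, smul_right_tmul]).flip
    (fun l b x => by
      induction x using tensor_induction with
      | zero => simp
      | tmul m n => simp [smul_left_tmul, tmulₗ_apply, tmul_balanced]
      | add x y hx hy => simp only [smul_add, map_add, hx, hy])
    (fun a l x => by
      induction x using tensor_induction with
      | zero => simp
      | tmul m n => simp [smul_left_tmul, tmulₗ_apply]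
      | add x y hx hy => simp only [smul_add, map_add, hx, hy])
    (fun d l x => by
      induction x using tensor_induction with
      | zero => simp
      | tmul m n => simp [smul_right_tmul, tmulₗ_apply]
      | add x y hx hy => simp only [smul_add, map_add, hx, hy])

/-- The associativity isomorphism of the tensor product of bimodules. -/
def tensorAssoc : tensorObj (tensorObj L M) N ≅ tensorObj L (tensorObj M N) where
  hom := tensorAssocHom L M N
  inv := tensorAssocInv L M N
  hom_inv_id := tensorObj_tensorObj_hom_ext fun _ _ _ => rfl
  inv_hom_id := tensorObj_tensorObj_hom_ext' fun _ _ _ => rfl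

variable (k A B C D) in
/-- The associativity isomorphism of the tensor product of bimodules, naturally in all three
variables. -/
def tensorAssocIso : bifunctorComp₁₂ (tensorBimod k A B C) (tensorBimod k A C D) ≅
    bifunctorComp₂₃ (tensorBimod k A B D) (tensorBimod k B C D) :=
  NatIso.ofComponents (fun L => NatIso.ofComponents (fun M => NatIso.ofComponents
    (fun N => tensorAssoc L M N)
    (fun f => tensorObj_tensorObj_hom_ext fun _ _ _ => rfl))
    (fun f => by ext N : 2; exact tensorObj_tensorObj_hom_ext fun _ _ _ => rfl))
    (fun f => by ext M N : 4; exact tensorObj_tensorObj_hom_ext fun _ _ _ => rfl)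

end Associator

section Flatness

section InnerAction

variable {k A B C D : Type u} [Field k] [Ring A] [Algebra k A] [Ring B] [Algebra k B]
  [Ring C] [Algebra k C] [Ring D] [Algebra k D]
  (L : FGBimod k A B) (M : FGBimod k C D)

/-- The right action of `B ⊗ Cᵐᵒᵖ` on `L ⊗_k M` for bimodules `L` over `A`, `B` and `M` over
`C`, `D`: the element `b ⊗ op c` takes `l ⊗ m` to `l b ⊗ c m`. -/
def innerAction : B ⊗[k] Cᵐᵒᵖ →ₗ[k] Module.End k (L ⊗[k] M) :=
  Module.endTensorEndAlgHom.toLinearMap ∘ₗ TensorProduct.map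
    ((Algebra.lsmul k k L).toLinearMap ∘ₗ
      (Algebra.TensorProduct.includeRight : Bᵐᵒᵖ →ₐ[k] A ⊗[k] Bᵐᵒᵖ).toLinearMap ∘ₗ
      (MulOpposite.opLinearEquiv k).toLinearMap)
    ((Algebra.lsmul k k M).toLinearMap ∘ₗ
      (Algebra.TensorProduct.includeLeft : C →ₐ[k] C ⊗[k] Dᵐᵒᵖ).toLinearMap ∘ₗ
      (MulOpposite.opLinearEquiv k).symm.toLinearMap)

@[simp]
theorem innerAction_tmul (b : B) (c : Cᵐᵒᵖ) (l : L) (m : M) :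
    innerAction L M (b ⊗ₜ c) (l ⊗ₜ m) =
      (((1 : A) ⊗ₜ[k] MulOpposite.op b) • l) ⊗ₜ ((c.unop ⊗ₜ[k] (1 : Dᵐᵒᵖ)) • m) := by
  simp [innerAction, Module.endTensorEndAlgHom_apply]

theorem innerAction_mul (r s : B ⊗[k] Cᵐᵒᵖ) :
    innerAction L M (r * s) = innerAction L M s ∘ₗ innerAction L M r := by
  induction r using TensorProduct.induction_on with
  | zero => simp
  | add r r' hr hr' => rw [add_mul, map_add, hr, hr', map_add, LinearMap.comp_add]
  | tmul b c =>
    induction s using TensorProduct.induction_on with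
    | zero => simp
    | add s s' hs hs' => rw [mul_add, map_add, hs, hs', map_add, LinearMap.add_comp]
    | tmul b' c' =>
      refine TensorProduct.ext' fun l m => ?_
      simp [smul_smul]

theorem innerAction_map {L L' : FGBimod k A B} {M M' : FGBimod k C D} (f : L ⟶ L') (g : M ⟶ M')
    (r : B ⊗[k] Cᵐᵒᵖ) (z : L ⊗[k] M) :
    innerAction L' M' r
        (TensorProduct.map (f.hom.hom.restrictScalars k) (g.hom.hom.restrictScalars k) z) =
      TensorProduct.map (f.hom.hom.restrictScalars k) (g.hom.hom.restrictScalars k)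
        (innerAction L M r z) := by
  induction r using TensorProduct.induction_on with
  | zero => simp
  | add r s hr hs => simp only [map_add, LinearMap.add_apply, hr, hs]
  | tmul b c =>
    induction z using TensorProduct.induction_on with
    | zero => simp
    | add z w hz hw => simp only [map_add, hz, hw]
    | tmul l m => simp

end InnerAction

open MonoidalCategory

variable (k A B : Type u) [Field k] [Ring A] [Algebra k A] [Ring B] [Algebra k B]
  [FiniteDimensional k A] [FiniteDimensional k B]

/-- The vector space underlying a bimodule. -/
abbrev underlyingSpace : FGBimod k A B ⥤ ModuleCat.{u} k :=
  forget₂ (FGModuleCat.{u} (A ⊗[k] Bᵐᵒᵖ)) (ModuleCat.{u} (A ⊗[k] Bᵐᵒᵖ)) ⋙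
    ModuleCat.restrictScalars (algebraMap k (A ⊗[k] Bᵐᵒᵖ))

instance : PreservesFiniteLimits (underlyingSpace k A B) :=
  have : PreservesFiniteLimits
      (ModuleCat.restrictScalars.{u} (algebraMap k (A ⊗[k] Bᵐᵒᵖ))) :=
    ⟨fun _ _ _ => ⟨inferInstance⟩⟩
  comp_preservesFiniteLimits _ _

instance : PreservesFiniteColimits (underlyingSpace k A B) :=
  comp_preservesFiniteColimits _ _

variable {k A B} {C D : Type u} [Ring C] [Algebra k C] [FiniteDimensional k C] [Ring D]
  [Algebra k D] [FiniteDimensional k D]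

section Middle

variable {L : FGBimod k A B} {X : FGBimod k B C} {M : FGBimod k C D}

variable (L M) in
/-- The bilinear form of `evalMiddle`. -/
def evalMiddleBilin (φ : X →ₗ[B ⊗[k] Cᵐᵒᵖ] B ⊗[k] Cᵐᵒᵖ) :
    tensorObj L X →ₗ[k] M →ₗ[k] L ⊗[k] M :=
  tensorLift
    (LinearMap.mk₂ k (fun l x => innerAction L M (φ x) ∘ₗ TensorProduct.mk k L M l)
      (fun l l' x => by ext; simp) (fun c l x => by ext; simp)
      (fun l x x' => by ext; simp) (fun c l x => by ext; simp))
    fun l b x => by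
      ext m
      simp [innerAction_mul, ← Algebra.TensorProduct.one_def]

variable (L M) in
/-- The map `(l ⊗ x) ⊗ m ↦ (l ⊗ m) φ(x)` given by a linear form `φ` on the middle factor. -/
def evalMiddle (φ : X →ₗ[B ⊗[k] Cᵐᵒᵖ] B ⊗[k] Cᵐᵒᵖ) :
    tensorObj (tensorObj L X) M →ₗ[k] L ⊗[k] M :=
  tensorLift (evalMiddleBilin L M φ) fun y c m => by
    induction y using tensor_induction with
    | zero => simp only [smul_zero, map_zero, LinearMap.zero_apply]
    | tmul l x =>
      simp [evalMiddleBilin, smul_right_tmul, innerAction_mul, ← Algebra.TensorProduct.one_def]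
    | add y z hy hz => simp only [smul_add, map_add, LinearMap.add_apply, hy, hz]

theorem evalMiddle_tmul (φ : X →ₗ[B ⊗[k] Cᵐᵒᵖ] B ⊗[k] Cᵐᵒᵖ) (l : L) (x : X) (m : M) :
    evalMiddle L M φ (tmul _ M (tmul L X l x) m) = innerAction L M (φ x) (l ⊗ₜ m) := rfl

theorem evalMiddle_naturality_left (φ : X →ₗ[B ⊗[k] Cᵐᵒᵖ] B ⊗[k] Cᵐᵒᵖ) {L' : FGBimod k A B}
    (f : L ⟶ L') :
    evalMiddle L' M φ ∘ₗ (((tensorBimod k A C D).map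
        (((tensorBimod k A B C).map f).app X)).app M).hom.hom.restrictScalars k =
      (f.hom.hom.restrictScalars k).rTensor M ∘ₗ evalMiddle L M φ :=
  tensorObj_tensorObj_linearMap_ext fun l x m =>
    innerAction_map f (𝟙 M) (φ x) (l ⊗ₜ m)

theorem evalMiddle_naturality_right (φ : X →ₗ[B ⊗[k] Cᵐᵒᵖ] B ⊗[k] Cᵐᵒᵖ) {M' : FGBimod k C D}
    (g : M ⟶ M') :
    evalMiddle L M' φ ∘ₗ
        (((tensorBimod k A C D).obj (tensorObj L X)).map g).hom.hom.restrictScalars k =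
      (g.hom.hom.restrictScalars k).lTensor L ∘ₗ evalMiddle L M φ :=
  tensorObj_tensorObj_linearMap_ext fun l x m =>
    innerAction_map (𝟙 L) g (φ x) (l ⊗ₜ m)

variable (L M) in
/-- The map `l ⊗ m ↦ (l ⊗ x) ⊗ m`. -/
def insertMiddle (x : X) : L ⊗[k] M →ₗ[k] tensorObj (tensorObj L X) M :=
  TensorProduct.lift (tmulₗ (tensorObj L X) M ∘ₗ (tmulₗ L X).flip x)

theorem insertMiddle_innerAction (x : X) (r : B ⊗[k] Cᵐᵒᵖ) (l : L) (m : M) :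
    insertMiddle L M x (innerAction L M r (l ⊗ₜ m)) =
      tmulₗ (tensorObj L X) M (tmulₗ L X l (r • x)) m := by
  induction r using TensorProduct.induction_on with
  | zero => simp [zero_smul_bimod]
  | add r s hr hs => simp only [map_add, LinearMap.add_apply, add_smul, hr, hs]
  | tmul b c =>
    have h : b ⊗ₜ[k] c = ((1 : B) ⊗ₜ[k] c) * (b ⊗ₜ[k] (1 : Cᵐᵒᵖ)) := by simp
    rw [h, mul_smul, ← h]
    simp [insertMiddle, tmulₗ_apply, ← tmul_balanced, ← smul_right_tmul]

theorem sum_insertMiddle_evalMiddle {n : ℕ} {x : Fin n → X}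
    {φ : Fin n → X →ₗ[B ⊗[k] Cᵐᵒᵖ] B ⊗[k] Cᵐᵒᵖ} (h : ∀ y, ∑ i, φ i y • x i = y) :
    ∑ i, insertMiddle L M (x i) ∘ₗ evalMiddle L M (φ i) = LinearMap.id :=
  tensorObj_tensorObj_linearMap_ext fun l y m => by
    simp only [LinearMap.sum_apply, LinearMap.comp_apply, evalMiddle_tmul,
      insertMiddle_innerAction]
    simp only [← LinearMap.flip_apply (tmulₗ (tensorObj L X) M), ← map_sum, h]
    rfl

end Middle

variable (X : FGBimod k B C) [Projective X]

theorem preservesHomology_obj_tensorObj_of_projective (L : FGBimod k A B) :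
    ((tensorBimod k A C D).obj (tensorObj L X)).PreservesHomology := by
  obtain ⟨n, x, φ, h⟩ := exists_dualBasis X
  let H := (tensorBimod k A C D).obj (tensorObj L X) ⋙ underlyingSpace k A D
  let G := underlyingSpace k C D ⋙ tensorLeft ((underlyingSpace k A B).obj L)
  let α (i : Fin n) : H ⟶ G :=
    { app M := (ModuleCat.ofHom (evalMiddle L M (φ i)) :
        ModuleCat.of k (tensorObj (tensorObj L X) M) ⟶ ModuleCat.of k (L ⊗[k] M))
      naturality _ _ f := congrArg ModuleCat.ofHom (evalMiddle_naturality_right (φ i) f) }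
  let β (i : Fin n) : G ⟶ H :=
    { app M := (ModuleCat.ofHom (insertMiddle L M (x i)) :
        ModuleCat.of k (L ⊗[k] M) ⟶ ModuleCat.of k (tensorObj (tensorObj L X) M))
      naturality _ _ _ := ModuleCat.hom_ext (TensorProduct.ext' fun _ _ => rfl) }
  have : H.PreservesHomology := by
    refine preservesHomology_of_sum_retract Finset.univ α β ?_
    ext M : 3
    refine Eq.trans ?_ (sum_insertMiddle_evalMiddle h)
    simp only [NatTrans.app_sum, ModuleCat.hom_sum]
    rfl
  exact preservesHomology_of_comp_faithful _ (underlyingSpace k A D)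

theorem preservesHomology_flip_obj_comp_of_projective (M : FGBimod k C D) :
    ((tensorBimod k A B C).flip.obj X ⋙
      (tensorBimod k A C D).flip.obj M).PreservesHomology := by
  obtain ⟨n, x, φ, h⟩ := exists_dualBasis X
  let H := ((tensorBimod k A B C).flip.obj X ⋙ (tensorBimod k A C D).flip.obj M) ⋙
    underlyingSpace k A D
  let G := underlyingSpace k A B ⋙ tensorRight ((underlyingSpace k C D).obj M)
  let α (i : Fin n) : H ⟶ G :=
    { app L := (ModuleCat.ofHom (evalMiddle L M (φ i)) :
        ModuleCat.of k (tensorObj (tensorObj L X) M) ⟶ ModuleCat.of k (L ⊗[k] M))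
      naturality _ _ f := congrArg ModuleCat.ofHom (evalMiddle_naturality_left (φ i) f) }
  let β (i : Fin n) : G ⟶ H :=
    { app L := (ModuleCat.ofHom (insertMiddle L M (x i)) :
        ModuleCat.of k (L ⊗[k] M) ⟶ ModuleCat.of k (tensorObj (tensorObj L X) M))
      naturality _ _ _ := congrArg ModuleCat.ofHom (TensorProduct.ext' fun _ _ => rfl) }
  have : H.PreservesHomology := by
    refine preservesHomology_of_sum_retract Finset.univ α β ?_
    ext L : 3
    refine Eq.trans ?_ (sum_insertMiddle_evalMiddle h)
    simp only [NatTrans.app_sum, ModuleCat.hom_sum]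
    rfl
  exact preservesHomology_of_comp_faithful _ (underlyingSpace k A D)

theorem preservesHomology_flip_obj_tensorObj_of_projective (M : FGBimod k C D) :
    ((tensorBimod k A B D).flip.obj (tensorObj X M)).PreservesHomology :=
  let e : (tensorBimod k A B C).flip.obj X ⋙ (tensorBimod k A C D).flip.obj M ≅
      (tensorBimod k A B D).flip.obj (tensorObj X M) :=
    Functor.isoWhiskerRight (tensorAssocIso k A B C D)
      ((evaluation _ _).obj X ⋙ (evaluation _ _).obj M)
  have := preservesHomology_flip_obj_comp_of_projective (A := A) X M
  preservesHomology_of_iso e.symm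

theorem preservesHomology_obj_of_projective : ((tensorBimod k B C D).obj X).PreservesHomology :=
  have := preservesHomology_obj_tensorObj_of_projective (D := D) X (regularBimod k B)
  preservesHomology_of_iso ((tensorBimod k B C D).mapIso (tensorLeftUnitor X)).symm

theorem preservesHomology_flip_obj_of_projective :
    ((tensorBimod k A B C).flip.obj X).PreservesHomology :=
  have := preservesHomology_flip_obj_tensorObj_of_projective (A := A) X (regularBimod k C)
  preservesHomology_of_iso ((tensorBimod k A B C).flip.mapIso (tensorRightUnitor X)).symm

end Flatness

section Resolution

open HomologicalComplex

variable (k A B C : Type u) [Field k] [Ring A] [Algebra k A] [Ring B] [Algebra k B]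
  [Ring C] [Algebra k C]
  [FiniteDimensional k A] [FiniteDimensional k B] [FiniteDimensional k C]

/-- The tensor product of bounded above complexes of bimodules. -/
abbrev tensorCMinus : CMinus (FGBimod k A B) ⥤ CMinus (FGBimod k B C) ⥤ CMinus (FGBimod k A C) :=
  mapBifunctorCMinus (tensorBimod k A B C)

/-- A resolution of the bimodule `B` by projective bimodules. -/
def regularResolution : CMinus (FGBimod k B B) :=
  ⟨(projectiveResolution (regularBimod k B)).cochainComplex, 0, inferInstance⟩

/-- The augmentation of the resolution of `B`. -/
def regularAugmentation : regularResolution k B ⟶ singleCMinus (regularBimod k B) :=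
  ObjectProperty.homMk (projectiveResolution (regularBimod k B)).π'

instance projective_regularResolution_X (n : ℤ) : Projective ((regularResolution k B).obj.X n) :=
  inferInstanceAs (Projective ((projectiveResolution (regularBimod k B)).cochainComplex.X n))

instance preservesHomology_obj_regularResolution_X (n : ℤ) :
    ((tensorBimod k B B C).obj ((regularResolution k B).obj.X n)).PreservesHomology :=
  preservesHomology_obj_of_projective _

instance preservesHomology_flip_obj_regularResolution_X (n : ℤ) :
    ((tensorBimod k A B B).flip.obj ((regularResolution k B).obj.X n)).PreservesHomology :=
  preservesHomology_flip_obj_of_projective _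

instance quasiIso_regularAugmentation : QuasiIso (regularAugmentation k B).hom :=
  inferInstanceAs (QuasiIso (projectiveResolution (regularBimod k B)).π')

instance preservesHomology_obj_regularBimod :
    ((tensorBimod k B B C).obj (regularBimod k B)).PreservesHomology :=
  preservesHomology_of_iso (tensorLeftUnitorIso k B C)

instance preservesHomology_flip_obj_regularBimod :
    ((tensorBimod k A B B).flip.obj (regularBimod k B)).PreservesHomology :=
  preservesHomology_of_iso (tensorRightUnitorIso k A B)

variable {k A B C}

theorem qis_of_isIso {𝒜 : Type*} [Category* 𝒜] [HasZeroMorphisms 𝒜] [CategoryWithHomology 𝒜]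
    {K L : CMinus 𝒜} (f : K ⟶ L) [IsIso f] : qis 𝒜 f := by
  have : IsIso f.hom := inferInstanceAs (IsIso ((boundedAbove 𝒜).ι.map f))
  exact inferInstanceAs (QuasiIso f.hom)

/-- The resolution `P ⊗_B M ⟶ M`, where `P` is the resolution of `B`. -/
def resolutionCounit : (tensorCMinus k B B C).obj (regularResolution k B) ⟶ 𝟭 _ :=
  (tensorCMinus k B B C).map (regularAugmentation k B) ≫
    (unitorCMinus (tensorLeftUnitorIso k B C)).hom

theorem qis_resolutionCounit_app (M : CMinus (FGBimod k B C)) : qis _ (resolutionCounit.app M) :=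
  (qis _).comp_mem _ _
    (quasiIso_mapBifunctorMap_of_exact_of_projective (F := tensorBimod k B B C)
      (fun Y _ => preservesHomology_flip_obj_of_projective Y) (regularAugmentation k B) M)
    (qis_of_isIso _)

theorem exists_qis_tensor_regularResolution (L : CMinus (FGBimod k A B)) :
    ∃ ε : ((tensorCMinus k A B B).obj L).obj (regularResolution k B) ⟶ L, qis _ ε := by
  let F := tensorBimod k A B B
  let e := (mapBifunctorFlipIso L.obj (singleCMinus (regularBimod k B)).obj F
      (ComplexShape.up ℤ)).symm ≪≫
    (boundedAbove _).ι.mapIso ((unitorCMinus (tensorRightUnitorIso k A B)).app L)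
  refine ⟨((tensorCMinus k A B B).obj L).map (regularAugmentation k B) ≫
    ((boundedAbove _).isoMk e).hom, (qis _).comp_mem _ _ ?_ (qis_of_isIso _)⟩
  exact (quasiIso_mapBifunctorMap_flip_iff F (𝟙 L) (regularAugmentation k B)).1
    (quasiIso_mapBifunctorMap_of_exact_of_projective (F := F.flip)
      (fun Y _ => preservesHomology_obj_of_projective Y) (regularAugmentation k B) L)

theorem preservesHomology_flip_obj_regularResolution_tensor (M : CMinus (FGBimod k B C)) (n : ℤ) :
    ((tensorBimod k A B C).flip.obj
      ((((tensorCMinus k B B C).obj (regularResolution k B)).obj M).obj.X n)).PreservesHomology :=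
  have (p q : ℤ) : ((tensorBimod k A B C).flip.obj (((tensorBimod k B B C).obj
      ((regularResolution k B).obj.X p)).obj (M.obj.X q))).PreservesHomology :=
    preservesHomology_flip_obj_tensorObj_of_projective _ _
  preservesHomology_obj_total_X (F := tensorBimod k B B C) _ M (tensorBimod k A B C).flip n

instance preservesHomology_obj_tensor_regularResolution (L : CMinus (FGBimod k A B)) (n : ℤ) :
    ((tensorBimod k A B C).obj
      ((((tensorCMinus k A B B).obj L).obj (regularResolution k B)).obj.X n)).PreservesHomology :=
  have (p q : ℤ) : ((tensorBimod k A B C).obj (((tensorBimod k A B B).obj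
      (L.obj.X p)).obj ((regularResolution k B).obj.X q))).PreservesHomology :=
    preservesHomology_obj_tensorObj_of_projective _ _
  preservesHomology_obj_total_X (F := tensorBimod k A B B) L _ (tensorBimod k A B C) n

theorem qis_tensorCMinus_map_app {K K' : CMinus (FGBimod k A B)} {f : K ⟶ K'} (hf : qis _ f)
    (L : CMinus (FGBimod k B C))
    [∀ q, ((tensorBimod k A B C).flip.obj (L.obj.X q)).PreservesHomology] :
    qis _ (((tensorCMinus k A B C).map f).app L) :=
  have : QuasiIso f.hom := hf
  quasiIso_mapBifunctorMap_of_exact_rows (F := tensorBimod k A B C) f L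

theorem qis_tensorCMinus_obj_map (L : CMinus (FGBimod k A B)) {X Y : CMinus (FGBimod k B C)}
    [∀ q, ((tensorBimod k A B C).flip.obj (X.obj.X q)).PreservesHomology]
    [∀ q, ((tensorBimod k A B C).flip.obj (Y.obj.X q)).PreservesHomology]
    {f : X ⟶ Y} (hf : qis _ f) : qis _ (((tensorCMinus k A B C).obj L).map f) := by
  obtain ⟨ε, hε⟩ := exists_qis_tensor_regularResolution L
  have : QuasiIso f.hom := hf
  have : QuasiIso ε.hom := hε
  exact quasiIso_mapBifunctorMap_of_quasiIso_left (F := tensorBimod k A B C) ε f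

theorem qis_regularResolution_tensor_map {M M' : CMinus (FGBimod k B C)} {f : M ⟶ M'}
    (hf : qis _ f) :
    qis _ (((tensorCMinus k B B C).obj (regularResolution k B)).map f) :=
  have : QuasiIso f.hom := hf
  quasiIso_mapBifunctorMap_of_exact_columns (F := tensorBimod k B B C) (regularResolution k B) f

end Resolution

section Precomposition

open Functor

variable {C₁ C₂ C₃ C₁₂ C₂₃ C₄ : Type*} [Category* C₁] [Category* C₂] [Category* C₃] [Category* C₁₂]
  [Category* C₂₃] [Category* C₄]

/-- Precomposition in the second variable, before and after currying. -/
def curryProdCompUncurryIso (F : C₁ ⥤ C₂ ⥤ C₁₂) (P : C₂ ⥤ C₂) (L : C₁₂ ⥤ C₄) :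
    curry.obj ((𝟭 C₁).prod P ⋙ uncurry.obj F ⋙ L) ≅
      (F ⋙ (whiskeringLeft _ _ _).obj P) ⋙ (whiskeringRight _ _ _).obj L :=
  NatIso.ofComponents (fun X₁ => NatIso.ofComponents (fun X₂ => Iso.refl _)
    (by intros; simp)) (by intros; ext; simp)

variable {F₁₂ : C₁ ⥤ C₂ ⥤ C₁₂} {G : C₁₂ ⥤ C₃ ⥤ C₄} {F : C₁ ⥤ C₂₃ ⥤ C₄}
  {G₂₃ : C₂ ⥤ C₃ ⥤ C₂₃} {P : C₂ ⥤ C₂} {P₂₃ : C₂₃ ⥤ C₂₃}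

/-- An associativity isomorphism for bifunctors whose second variables are replaced by functors
of them. -/
def bifunctorCompPrecompIso (a : bifunctorComp₁₂ F₁₂ G ≅ bifunctorComp₂₃ F G₂₃)
    (b : P ⋙ G₂₃ ≅ G₂₃ ⋙ (whiskeringRight _ _ _).obj P₂₃) (P' : C₃ ⥤ C₃) :
    bifunctorComp₁₂ (F₁₂ ⋙ (whiskeringLeft _ _ _).obj P) (G ⋙ (whiskeringLeft _ _ _).obj P') ≅
      bifunctorComp₂₃ (F ⋙ (whiskeringLeft _ _ _).obj P₂₃)
        (G₂₃ ⋙ (whiskeringLeft _ _ _).obj P') :=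
  let a' : bifunctorComp₁₂ (F₁₂ ⋙ (whiskeringLeft _ _ _).obj P)
        (G ⋙ (whiskeringLeft _ _ _).obj P') ≅
      bifunctorComp₂₃ F ((P ⋙ G₂₃) ⋙ (whiskeringLeft _ _ _).obj P') :=
    isoWhiskerRight a ((whiskeringLeft _ _ _).obj P ⋙
      (whiskeringRight _ _ _).obj ((whiskeringLeft _ _ _).obj P'))
  let b' : bifunctorComp₂₃ F ((P ⋙ G₂₃) ⋙ (whiskeringLeft _ _ _).obj P') ≅
      bifunctorComp₂₃ (F ⋙ (whiskeringLeft _ _ _).obj P₂₃)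
        (G₂₃ ⋙ (whiskeringLeft _ _ _).obj P') :=
    (bifunctorComp₂₃Functor.obj F).mapIso (isoWhiskerRight b ((whiskeringLeft _ _ _).obj P'))
  a' ≪≫ b'

end Precomposition

section DerivedTensorExistence

variable (k A B C D : Type u) [Field k] [Ring A] [Algebra k A] [Ring B] [Algebra k B]
  [Ring C] [Algebra k C] [Ring D] [Algebra k D]
  [FiniteDimensional k A] [FiniteDimensional k B] [FiniteDimensional k C] [FiniteDimensional k D]

/-- The functorial resolution `(L, M) ↦ (L, P ⊗_B M)`, where `P` is the resolution of `B`. -/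
def resolveRight : CMinus (FGBimod k A B) × CMinus (FGBimod k B C) ⥤
    CMinus (FGBimod k A B) × CMinus (FGBimod k B C) :=
  (𝟭 _).prod ((tensorCMinus k B B C).obj (regularResolution k B))

/-- The augmentation `(L, P ⊗_B M) ⟶ (L, M)`. -/
def resolveRightCounit : resolveRight k A B C ⟶ 𝟭 _ where
  app X := Prod.mkHom (𝟙 X.1) (resolutionCounit.app X.2)
  naturality _ _ f := Prod.hom_ext ((Category.comp_id _).trans (Category.id_comp _).symm)
    (resolutionCounit.naturality f.2)

instance preservesHomology_flip_obj_resolveRight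
    (X : CMinus (FGBimod k A B) × CMinus (FGBimod k B C)) (q : ℤ) :
    ((tensorBimod k A B C).flip.obj
      (((resolveRight k A B C).obj X).2.obj.X q)).PreservesHomology :=
  preservesHomology_flip_obj_regularResolution_tensor X.2 q

theorem isIso_tensorToDerived_map {X Y : CMinus (FGBimod k A B) × CMinus (FGBimod k B C)}
    (f : X ⟶ Y) (h₁ : qis _ (((tensorCMinus k A B C).map f.1).app X.2))
    (h₂ : qis _ (((tensorCMinus k A B C).obj Y.1).map f.2)) :
    IsIso ((tensorToDerived k A B C).map f) :=
  Localization.inverts (qis (FGBimod k A C)).Q (qis _) _ ((qis _).comp_mem _ _ h₁ h₂)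

theorem isInvertedBy_resolveRight_comp_tensorToDerived :
    ((qis (FGBimod k A B)).prod (qis (FGBimod k B C))).IsInvertedBy
      (resolveRight k A B C ⋙ tensorToDerived k A B C) := fun _ _ f hf =>
  isIso_tensorToDerived_map k A B C ((resolveRight k A B C).map f)
    (qis_tensorCMinus_map_app hf.1 _)
    (qis_tensorCMinus_obj_map _ (qis_regularResolution_tensor_map hf.2))

/-- The functor on derived categories induced by `(L, M) ↦ L ⊗_B (P ⊗_B M)`. -/
def resolvedDerivedTensor : DMinusBimod k A B × DMinusBimod k B C ⥤ DMinusBimod k A C :=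
  Localization.lift (resolveRight k A B C ⋙ tensorToDerived k A B C)
    (isInvertedBy_resolveRight_comp_tensorToDerived k A B C)
    ((qis (FGBimod k A B)).Q.prod (qis (FGBimod k B C)).Q)

/-- The counit of `resolvedDerivedTensor`, induced by `P ⊗_B M ⟶ M`. -/
def resolvedDerivedTensorCounit :
    (qis (FGBimod k A B)).Q.prod (qis (FGBimod k B C)).Q ⋙ resolvedDerivedTensor k A B C ⟶
      tensorToDerived k A B C :=
  deformationCounit _ ((qis (FGBimod k A B)).prod (qis (FGBimod k B C))) _
    (resolveRightCounit k A B C) (isInvertedBy_resolveRight_comp_tensorToDerived k A B C)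

instance isLeftDerivedFunctor_resolvedDerivedTensor :
    (resolvedDerivedTensor k A B C).IsLeftDerivedFunctor (resolvedDerivedTensorCounit k A B C)
      ((qis (FGBimod k A B)).prod (qis (FGBimod k B C))) :=
  isLeftDerivedFunctor_of_deformation
    (fun X => ⟨(qis _).id_mem _, qis_resolutionCounit_app X.2⟩)
    (fun X => isIso_tensorToDerived_map k A B C _
      (qis_of_isIso (((tensorCMinus k A B C).map (𝟙 X.1)).app _))
      (qis_tensorCMinus_obj_map (Y := ((resolveRight k A B C).obj X).2) _
        (qis_resolutionCounit_app _)))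

theorem hasDerivedTensor : HasDerivedTensor k A B C :=
  Functor.HasLeftDerivedFunctor.mk' _ (resolvedDerivedTensorCounit k A B C)

/-- The bifunctor `(L, M) ↦ L ⊗_B (P ⊗_B M)`, where `P` is the resolution of `B`. -/
def resolvedTensor :
    CMinus (FGBimod k A B) ⥤ CMinus (FGBimod k B C) ⥤ CMinus (FGBimod k A C) :=
  tensorCMinus k A B C ⋙
    (Functor.whiskeringLeft _ _ _).obj ((tensorCMinus k B B C).obj (regularResolution k B))

/-- The derived tensor product is computed by `L ⊗_B (P ⊗_B M)`. -/
def prodCompTotalLeftDerivedIso [HasDerivedTensor k A B C] :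
    (qis (FGBimod k A B)).Q.prod (qis (FGBimod k B C)).Q ⋙
      (tensorToDerived k A B C).totalLeftDerived
        ((qis (FGBimod k A B)).Q.prod (qis (FGBimod k B C)).Q)
        ((qis (FGBimod k A B)).prod (qis (FGBimod k B C))) ≅
    resolveRight k A B C ⋙ tensorToDerived k A B C :=
  Functor.isoWhiskerLeft _ (Functor.leftDerivedUnique _ _
    (Functor.totalLeftDerivedCounit _ _ _) (resolvedDerivedTensorCounit k A B C)
    ((qis (FGBimod k A B)).prod (qis (FGBimod k B C)))) ≪≫
  Localization.fac _ (isInvertedBy_resolveRight_comp_tensorToDerived k A B C) _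

instance lifting₂_derivedTensor [HasDerivedTensor k A B C] :
    Localization.Lifting₂ (qis (FGBimod k A B)).Q (qis (FGBimod k B C)).Q
      (qis (FGBimod k A B)) (qis (FGBimod k B C))
      (resolvedTensor k A B C ⋙ (Functor.whiskeringRight _ _ _).obj (qis (FGBimod k A C)).Q)
      (derivedTensor k A B C) where
  iso := (Functor.curryObjProdComp _ _ _).symm ≪≫
    Functor.curry.mapIso (prodCompTotalLeftDerivedIso k A B C) ≪≫
      curryProdCompUncurryIso _ _ _

/-- The isomorphism `(L ⊗ (P_B ⊗ M)) ⊗ (P_C ⊗ N) ≅ L ⊗ (P_B ⊗ (M ⊗ (P_C ⊗ N)))`. -/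
def resolvedTensorAssoc : bifunctorComp₁₂ (resolvedTensor k A B C) (resolvedTensor k A C D) ≅
    bifunctorComp₂₃ (resolvedTensor k A B D) (resolvedTensor k B C D) :=
  bifunctorCompPrecompIso (associatorCMinus (tensorAssocIso k A B C D))
    ((associatorCMinus (tensorAssocIso k B B C D)).app (regularResolution k B)) _

/-- The isomorphism `(L ⊗ᴸ_B M) ⊗ᴸ_C N ≅ L ⊗ᴸ_B (M ⊗ᴸ_C N)`, natural in all three variables. -/
def derivedTensorAssoc [HasDerivedTensor k A B C] [HasDerivedTensor k A C D]
    [HasDerivedTensor k A B D] [HasDerivedTensor k B C D] :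
    bifunctorComp₁₂ (derivedTensor k A B C) (derivedTensor k A C D) ≅
      bifunctorComp₂₃ (derivedTensor k A B D) (derivedTensor k B C D) :=
  Localization.associator (qis (FGBimod k A B)).Q (qis (FGBimod k B C)).Q (qis (FGBimod k C D)).Q
    (qis (FGBimod k A C)).Q (qis (FGBimod k B D)).Q (qis (FGBimod k A D)).Q
    (qis (FGBimod k A B)) (qis (FGBimod k B C)) (qis (FGBimod k C D)) (qis (FGBimod k A C))
    (qis (FGBimod k B D)) (resolvedTensorAssoc k A B C D)
    (derivedTensor k A B C) (derivedTensor k A C D) (derivedTensor k A B D) (derivedTensor k B C D)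

end DerivedTensorExistence

end DerivedTensor

end

/-- The derived tensor products over `B` and `C` exist, and `(L ⊗ᴸ_B M) ⊗ᴸ_C N` and
`L ⊗ᴸ_B (M ⊗ᴸ_C N)` are isomorphic as functors of the triple
`(L, M, N)` in `D⁻(A ⊗ Bᵒᵖ) × D⁻(B ⊗ Cᵒᵖ) × D⁻(C ⊗ Dᵒᵖ)`. Fixing any two of the three variables,
for instance as bounded complexes, gives the isomorphisms of functors in the remaining one. -/
theorem lemma2p3 (k A B C D : Type u) [Field k]
    [Ring A] [Algebra k A] [FiniteDimensional k A]
    [Ring B] [Algebra k B] [FiniteDimensional k B]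
    [Ring C] [Algebra k C] [FiniteDimensional k C]
    [Ring D] [Algebra k D] [FiniteDimensional k D] :
    ∃ (_ : DerivedTensor.HasDerivedTensor k A B C) (_ : DerivedTensor.HasDerivedTensor k A C D)
      (_ : DerivedTensor.HasDerivedTensor k A B D) (_ : DerivedTensor.HasDerivedTensor k B C D),
      Nonempty (bifunctorComp₁₂ (DerivedTensor.derivedTensor k A B C) (DerivedTensor.derivedTensor k A C D) ≅
        bifunctorComp₂₃ (DerivedTensor.derivedTensor k A B D) (DerivedTensor.derivedTensor k B C D)) := by
  have hABC := DerivedTensor.hasDerivedTensor k A B C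
  have hACD := DerivedTensor.hasDerivedTensor k A C D
  have hABD := DerivedTensor.hasDerivedTensor k A B D
  have hBCD := DerivedTensor.hasDerivedTensor k B C D
  exact ⟨hABC, hACD, hABD, hBCD, ⟨DerivedTensor.derivedTensorAssoc k A B C D⟩⟩
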